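/- Fix an integer $n\ge 3$, let $\mu=2\cos(\pi/3)=1$, $t=\mu+2\cos(\pi/n)$, and let $A=\begin{pmatrix}1&t\\0&1\end{pmatrix}$, $C=\begin{pmatrix}-\mu&1\\-1&0\end{pmatrix}$ act on $\mathbb R\cup\{\infty\}$ by Möbius transformations. For $\alpha\in[0,1]$ let $\mathbb I_\alpha=[(\alpha-1)t,\alpha t)$ and, for $x\in[(\alpha-1)t,\alpha t]$, let $T_\alpha(x)=A^kC^l\cdot x$, where $l\ge1$ is minimal with $C^l\cdot x\notin\mathbb I_\alpha$ and $k=-\lfloor (C^l\cdot x)/t+1-\alpha\rfloor$; the pair $(k,l)$ is the $\alpha$-digit of $x$ (a point with $C^l\cdot x=\infty$ has no digit, and one sets $T_\alpha(x)=\infty$). Put $\ell_0(\alpha)=(\alpha-1)t$, $r_0(\alpha)=\alpha t$, $\ell_i(\alpha)=T_\alpha^i(\ell_0(\alpha))$, $r_j(\alpha)=T_\alpha^j(r_0(\alpha))$. A digit of the form $(k,1)$ is abbreviated to the simplified digit $k$. Words. For a word $v=c_1d_1c_2\cdots d_{s-1}c_s$ of positive integers let $v'=1\,(c_1-1)\,d_1c_2\cdots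 c_s$ if $c_1\ne1$ and $v'=(d_1+1)\,c_2\cdots c_s$ if $c_1=1$ (so $c'=1\,(c-1)$ for $v=c>1$, and $1'=1$). Let $\Theta_{-1}(c)=c+1$ for $c\ge1$; $\Theta_q(1)=1q1$ for $q\ge1$; $\Theta_q(c)=c\,[1(c-1)]^q\,1c$ for $c>1$, $q\ge0$; and, if $v=\Theta_p(u)=uv''$ with $p\ge0$, let $\Theta_q(v)=v(v')^qv''$ for $q\ge0$. Let $\mathcal V$ be the set of all words obtained from the word $1$ by finitely many applications of the $\Theta_q$. For $k\ge1$ and $v=c_1d_1\cdots d_{s-1}c_s\in\mathcal V$ let $$R_{k,v}=(A^kC)^{c_s}(A^{k+1}C)^{d_{s-1}}\cdots(A^{k+1}C)^{d_1}(A^kC)^{c_1},$$ and let $\mathscr J_{k,v}=[\zeta_{k,v},\eta_{k,v})$, where $\zeta=\zeta_{k,v}$ and $\eta=\eta_{k,v}$ are the (unique) parameters in $[0,1]$ with $R_{k,v}\cdot r_0(\zeta)=\ell_0(\zeta)$ and $r_0(\eta)=C^{-1}ACR_{k,v}\cdot r_0(\eta)$. Let $w=(-1)^{n-2},-2,(-1)^{n-3},-2$,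 let $\mathcal C=(-1)^{n-3},-2,w^{k-1}$ and $\mathcal D=(-1)^{n-3},-2,w^{k}$ (exponents denote repetition), and let $$\underline d(k,v)=(-1)^{n-2},-2,\;\mathcal C^{c_1}\mathcal D^{d_1}\cdots\mathcal D^{d_{s-1}}\mathcal C^{c_s},\;(-1)^{n-2},$$ a sequence of length $\underline S$. Let $W=A^{-2}C(A^{-1}C)^{n-3}A^{-2}C(A^{-1}C)^{n-2}$, $\tilde{\mathcal C}=W^{k-1}A^{-2}C(A^{-1}C)^{n-3}$, $\tilde{\mathcal D}=W^{k}A^{-2}C(A^{-1}C)^{n-3}$ and $$L_{k,v}=(A^{-1}C)^{n-2}\,\tilde{\mathcal C}^{c_s}\tilde{\mathcal D}^{d_{s-1}}\cdots\tilde{\mathcal D}^{d_1}\tilde{\mathcal C}^{c_1}\,A^{-2}C(A^{-1}C)^{n-2}A^{-1}.$$ Finally let $\overline S=c_1+d_1+\cdots+d_{s-1}+c_s$. Proposition. Let $n\ge3$, $k\ge1$ and $v\in\mathcal V$. Then: (1) for every $\alpha\in\mathscr J_{k,v}$, the first $\underline S$ $\alpha$-digits of $\ell_0(\alpha)$ are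 all of the form $(\cdot,1)$, and as a sequence of simplified digits they are exactly $\underline d(k,v)$; (2) $L_{k,v}=\pm\,C^{-1}AC\,R_{k,v}$; (3) synchronization occurs at every $\alpha\in\mathscr J_{k,v}$, with the same pair of indices: $\ell_{\underline S}(\alpha)=C^{-1}AC\cdot r_{\overline S}(\alpha)$ and $\ell_{\underline S+1}(\alpha)=r_{\overline S+1}(\alpha)$. -/

import Mathlib

open OnePoint

namespace AlphaCF

noncomputable section

/-! ### The groups and the maps

Throughout `m = 3`, so `μ = 2 cos (π / 3)`.  Elements of `GL(2, ℝ)` act on the projective line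
`OnePoint ℝ = ℝ ∪ {∞}` by Möbius transformations. -/

/-- `μ = μ₃ = 2 cos (π / 3)`. -/
def mu : ℝ := 2 * Real.cos (Real.pi / 3)

/-- The translation length `t = t_{3,n} = 2 cos (π / 3) + 2 cos (π / n)`. -/
def tr (n : ℕ) : ℝ := mu + 2 * Real.cos (Real.pi / n)

/-- The generator `A`, acting as `x ↦ x + t`. -/
def matA (n : ℕ) : GL (Fin 2) ℝ :=
  Matrix.GeneralLinearGroup.mkOfDetNeZero !![1, tr n; 0, 1] (by simp [Matrix.det_fin_two])

/-- The generator `C`, acting as `x ↦ μ - 1 / x`. -/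
def matC : GL (Fin 2) ℝ :=
  Matrix.GeneralLinearGroup.mkOfDetNeZero !![-mu, 1; -1, 0] (by simp [Matrix.det_fin_two])

/-- The half-open interval `𝕀_α = [(α - 1) t, α t)`, inside the projective line. -/
def interval (n : ℕ) (α : ℝ) : Set (OnePoint ℝ) :=
  (fun x : ℝ => (x : OnePoint ℝ)) '' Set.Ico ((α - 1) * tr n) (α * tr n)

/-- The closed interval `[(α - 1) t, α t]`, inside the projective line. -/
def closedInterval (n : ℕ) (α : ℝ) : Set (OnePoint ℝ) :=
  (fun x : ℝ => (x : OnePoint ℝ)) '' Set.Icc ((α - 1) * tr n) (α * tr n)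

/-- The exponents `l ≥ 1` such that `C ^ l • x` lies outside `𝕀_α`. -/
def exitExponents (n : ℕ) (α : ℝ) (x : OnePoint ℝ) : Set ℕ :=
  {l | 1 ≤ l ∧ matC ^ l • x ∉ interval n α}

/-- For real `y`, the exponent `k = -⌊y / t + 1 - α⌋` for which `A ^ k • y` lies in `𝕀_α`.
(The value at `y = ∞` is immaterial, since `A` fixes `∞`.) -/
def returnExponent (n : ℕ) (α : ℝ) (y : OnePoint ℝ) : ℤ :=
  -⌊y.elim 0 (fun r => r) / tr n + 1 - α⌋

/-- The map `T_α = T_{3,n,α} : x ↦ A ^ k C ^ l • x`, with `l ≥ 1` minimal such that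
`C ^ l • x ∉ 𝕀_α` and `k = -⌊(C ^ l • x) / t + 1 - α⌋`.  A point with `C ^ l • x = ∞`
is sent to `∞`. -/
def cfMap (n : ℕ) (α : ℝ) (x : OnePoint ℝ) : OnePoint ℝ :=
  matA n ^ returnExponent n α (matC ^ sInf (exitExponents n α x) • x) •
    (matC ^ sInf (exitExponents n α x) • x)

/-- The left endpoint `ℓ₀(α) = (α - 1) t`. -/
def leftEnd (n : ℕ) (α : ℝ) : OnePoint ℝ := (((α - 1) * tr n : ℝ) : OnePoint ℝ)

/-- The right endpoint `r₀(α) = α t`. -/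
def rightEnd (n : ℕ) (α : ℝ) : OnePoint ℝ := ((α * tr n : ℝ) : OnePoint ℝ)

/-- `ℓ_i(α) = T_α^i (ℓ₀(α))`. -/
def leftOrbit (n : ℕ) (α : ℝ) (i : ℕ) : OnePoint ℝ := (cfMap n α)^[i] (leftEnd n α)

/-- `r_j(α) = T_α^j (r₀(α))`. -/
def rightOrbit (n : ℕ) (α : ℝ) (j : ℕ) : OnePoint ℝ := (cfMap n α)^[j] (rightEnd n α)

/-- The cylinder `Δ_α(k, l)`: the points of `[(α - 1) t, α t]` on which `T_α` is defined and is
given by `A ^ k C ^ l`; that is, the points whose `α`-digit is `(k, l)`. -/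
def cylinder (n : ℕ) (α : ℝ) (k : ℤ) (l : ℕ) : Set (OnePoint ℝ) :=
  {x | x ∈ closedInterval n α ∧ IsLeast (exitExponents n α x) l ∧
    matC ^ l • x ≠ ∞ ∧ returnExponent n α (matC ^ l • x) = k}

/-- The sequence of `α`-digits of (the orbit of) `x` begins with the given list of digits. -/
def HasInitialDigits (n : ℕ) (α : ℝ) (x : OnePoint ℝ) (b : List (ℤ × ℕ)) : Prop :=
  ∀ (i : ℕ) (hi : i < b.length), (cfMap n α)^[i] x ∈ cylinder n α b[i].1 b[i].2

/-- The sequence of simplified digits of `x` begins with `d`: the `α`-digits begin with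
`(d₁, 1), (d₂, 1), …`. -/
def HasInitialSimplifiedDigits (n : ℕ) (α : ℝ) (x : OnePoint ℝ) (d : List ℤ) : Prop :=
  HasInitialDigits n α x (d.map fun k => (k, 1))

/-! ### The tree of words

A word `v = c₁ d₁ c₂ ⋯ d_{s-1} c_s` is the list `[c₁, d₁, c₂, …, d_{s-1}, c_s]`. -/

/-- The `q`-fold concatenation `z ^ q` of a list. -/
def listPow {X : Type*} (z : List X) (q : ℕ) : List X := (List.replicate q z).flatten

/-- The word `v'`: it is `1 (c₁ - 1) d₁ c₂ ⋯ c_s` if `c₁ ≠ 1` and `(d₁ + 1) c₂ ⋯ c_s` if `c₁ = 1`;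
for one-letter words, `c' = 1 (c - 1)` if `c > 1` and `1' = 1`. -/
def prime : List ℕ → List ℕ
  | [] => []
  | [1] => [1]
  | 1 :: d :: v => (d + 1) :: v
  | c :: v => 1 :: (c - 1) :: v

/-- `Theta q u v` means `v = Θ_q(u)`. -/
inductive Theta : ℤ → List ℕ → List ℕ → Prop
  | succ (c : ℕ) (hc : 1 ≤ c) : Theta (-1) [c] [c + 1]
  | one (q : ℕ) (hq : 1 ≤ q) : Theta q [1] [1, q, 1]
  | single (q c : ℕ) (hc : 1 < c) : Theta q [c] ([c] ++ listPow [1, c - 1] q ++ [1, c])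
  | step (p q : ℕ) (u v v'' : List ℕ) (h : Theta p u v) (hv : v = u ++ v'') :
      Theta q v (v ++ listPow (prime v) q ++ v'')

/-- The tree `𝒱` of all words obtained from the word `1` by finitely many applications of the
operators `Θ_q`. -/
def words : Set (List ℕ) :=
  {v | Relation.ReflTransGen (fun u u' => ∃ q, Theta q u u') [1] v}

/-! ### Upper digits, right matrices and potential synchronization intervals -/

/-- The upper simplified digit sequence
`k ^ c₁, (k + 1) ^ d₁, …, (k + 1) ^ d_{s-1}, k ^ c_s` of `k, v`. -/
def upperDigits (k : ℕ) : List ℕ → List ℤ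
  | [] => []
  | [c] => List.replicate c (k : ℤ)
  | c :: d :: v => List.replicate c (k : ℤ) ++ List.replicate d ((k : ℤ) + 1) ++ upperDigits k v

/-- `R_{k,v} = (A^k C)^{c_s} (A^{k+1} C)^{d_{s-1}} ⋯ (A^{k+1} C)^{d₁} (A^k C)^{c₁}`. -/
def rightMatrix (n k : ℕ) : List ℕ → GL (Fin 2) ℝ
  | [] => 1
  | [c] => (matA n ^ k * matC) ^ c
  | c :: d :: v =>
      rightMatrix n k v * (matA n ^ (k + 1) * matC) ^ d * (matA n ^ k * matC) ^ c

/-- `ζ = ζ_{k,v}`: the parameter in `[0, 1]` with `R_{k,v} • r₀(ζ) = ℓ₀(ζ)`. -/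
def IsZeta (n k : ℕ) (v : List ℕ) (ζ : ℝ) : Prop :=
  ζ ∈ Set.Icc (0 : ℝ) 1 ∧ rightMatrix n k v • rightEnd n ζ = leftEnd n ζ

/-- `η = η_{k,v}`: the parameter in `[0, 1]` with `r₀(η) = C⁻¹ A C R_{k,v} • r₀(η)`. -/
def IsEta (n k : ℕ) (v : List ℕ) (η : ℝ) : Prop :=
  η ∈ Set.Icc (0 : ℝ) 1 ∧
    rightEnd n η = (matC⁻¹ * matA n * matC * rightMatrix n k v) • rightEnd n η

/-- The potential synchronization interval `𝒥_{k,v} = [ζ_{k,v}, η_{k,v})`.  Existence and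
uniqueness of the two endpoints is `syncInterval_eq_Ico` below. -/
def syncInterval (n k : ℕ) (v : List ℕ) : Set ℝ :=
  {α | ∃ ζ η : ℝ, IsZeta n k v ζ ∧ IsEta n k v η ∧ α ∈ Set.Ico ζ η}

/-! ### Lower digits and left matrices -/

/-- `w = w_{3,n} = (-1)^{n-2}, -2, (-1)^{n-3}, -2`. -/
def wordW (n : ℕ) : List ℤ :=
  List.replicate (n - 2) (-1) ++ [-2] ++ List.replicate (n - 3) (-1) ++ [-2]

/-- `𝒞_k = (-1)^{n-3}, -2, w^{k-1}`. -/
def blockC (n k : ℕ) : List ℤ :=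
  List.replicate (n - 3) (-1) ++ [-2] ++ listPow (wordW n) (k - 1)

/-- `𝒟_k = (-1)^{n-3}, -2, w^k`. -/
def blockD (n k : ℕ) : List ℤ :=
  List.replicate (n - 3) (-1) ++ [-2] ++ listPow (wordW n) k

/-- `𝒞^{c₁} 𝒟^{d₁} ⋯ 𝒟^{d_{s-1}} 𝒞^{c_s}`. -/
def blockDigits (n k : ℕ) : List ℕ → List ℤ
  | [] => []
  | [c] => listPow (blockC n k) c
  | c :: d :: v => listPow (blockC n k) c ++ listPow (blockD n k) d ++ blockDigits n k v

/-- The lower simplified digit sequence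
`(-1)^{n-2}, -2, 𝒞^{c₁} 𝒟^{d₁} ⋯ 𝒟^{d_{s-1}} 𝒞^{c_s}, (-1)^{n-2}` of `k, v`. -/
def lowerDigits (n k : ℕ) (v : List ℕ) : List ℤ :=
  List.replicate (n - 2) (-1) ++ [-2] ++ blockDigits n k v ++ List.replicate (n - 2) (-1)

/-- `W = A⁻² C (A⁻¹ C)^{n-3} A⁻² C (A⁻¹ C)^{n-2}`. -/
def matW (n : ℕ) : GL (Fin 2) ℝ :=
  (matA n ^ (-2 : ℤ) * matC) * ((matA n)⁻¹ * matC) ^ (n - 3) *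
    (matA n ^ (-2 : ℤ) * matC) * ((matA n)⁻¹ * matC) ^ (n - 2)

/-- The matrix of the block `𝒞_k`: `W^{k-1} A⁻² C (A⁻¹ C)^{n-3}`. -/
def matBlockC (n k : ℕ) : GL (Fin 2) ℝ :=
  matW n ^ (k - 1) * (matA n ^ (-2 : ℤ) * matC) * ((matA n)⁻¹ * matC) ^ (n - 3)

/-- The matrix of the block `𝒟_k`: `W^k A⁻² C (A⁻¹ C)^{n-3}`. -/
def matBlockD (n k : ℕ) : GL (Fin 2) ℝ :=
  matW n ^ k * (matA n ^ (-2 : ℤ) * matC) * ((matA n)⁻¹ * matC) ^ (n - 3)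

/-- The product of block matrices (in reverse order) along
`𝒞^{c₁} 𝒟^{d₁} ⋯ 𝒟^{d_{s-1}} 𝒞^{c_s}`. -/
def blockMatrix (n k : ℕ) : List ℕ → GL (Fin 2) ℝ
  | [] => 1
  | [c] => matBlockC n k ^ c
  | c :: d :: v => blockMatrix n k v * matBlockD n k ^ d * matBlockC n k ^ c

/-- The left matrix `L_{k,v} = (A⁻¹C)^{n-2} 𝒞̃^{c_s} 𝒟̃^{d_{s-1}} ⋯ 𝒟̃^{d₁} 𝒞̃^{c₁}
A⁻²C (A⁻¹C)^{n-2} A⁻¹`. -/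
def leftMatrix (n k : ℕ) (v : List ℕ) : GL (Fin 2) ℝ :=
  ((matA n)⁻¹ * matC) ^ (n - 2) * blockMatrix n k v *
    (matA n ^ (-2 : ℤ) * matC) * ((matA n)⁻¹ * matC) ^ (n - 2) * (matA n)⁻¹

end

/-! ### The endpoints of `𝒥_{k,v}` are well defined -/

theorem mu_eq : mu = 1 := by
  simp [mu, Real.cos_pi_div_three]

theorem two_le_tr {n : ℕ} (hn : 3 ≤ n) : 2 ≤ tr n := by
  have h : Real.cos (Real.pi / 3) ≤ Real.cos (Real.pi / n) := by
    have hn' : (3 : ℝ) ≤ n := by exact_mod_cast hn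
    have hpi := Real.pi_pos
    apply Real.cos_le_cos_of_nonneg_of_le_pi
    · positivity
    · linarith
    · gcongr
  rw [Real.cos_pi_div_three] at h
  rw [tr, mu_eq]
  linarith

/-- An inverse branch: on `[-t, 1/2]` the inverse of `M` is an increasing contraction into
`(0, 1/2]`. -/
def IsBranch (t : ℝ) (M : GL (Fin 2) ℝ) : Prop :=
  ∃ g : ℝ → ℝ, ∀ y : ℝ, -t ≤ y → y ≤ 1 / 2 →
    M⁻¹ • (y : OnePoint ℝ) = ((g y : ℝ) : OnePoint ℝ) ∧ 0 < g y ∧ g y ≤ 1 / 2 ∧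
      ∀ z : ℝ, y < z → z ≤ 1 / 2 → g y < g z ∧ g z - g y ≤ (z - y) / 2

theorem IsBranch.mul {t : ℝ} (ht : 2 ≤ t) {M N : GL (Fin 2) ℝ} (hM : IsBranch t M)
    (hN : IsBranch t N) : IsBranch t (M * N) := by
  obtain ⟨g, hg⟩ := hM
  obtain ⟨h, hh⟩ := hN
  refine ⟨fun y => h (g y), fun y hy1 hy2 => ?_⟩
  obtain ⟨a1, a2, a3, a4⟩ := hg y hy1 hy2
  obtain ⟨b1, b2, b3, b4⟩ := hh (g y) (by linarith) a3
  refine ⟨by rw [mul_inv_rev, mul_smul, a1, b1], b2, b3, fun z hz1 hz2 => ?_⟩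
  obtain ⟨c1, c2⟩ := a4 z hz1 hz2
  obtain ⟨-, -, d3, -⟩ := hg z (by linarith) hz2
  obtain ⟨e1, e2⟩ := b4 (g z) c1 d3
  exact ⟨e1, by linarith⟩

theorem IsBranch.pow {t : ℝ} (ht : 2 ≤ t) {M : GL (Fin 2) ℝ} (hM : IsBranch t M) {c : ℕ}
    (hc : 1 ≤ c) : IsBranch t (M ^ c) := by
  induction c, hc using Nat.le_induction with
  | base => simpa using hM
  | succ c _ ih => rw [pow_succ]; exact ih.mul ht hM

theorem matA_pow_smul (n k : ℕ) (y : ℝ) :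
    (matA n ^ k) • (y : OnePoint ℝ) = ((y + k * tr n : ℝ) : OnePoint ℝ) := by
  induction k with
  | zero => simp
  | succ k ih =>
    rw [pow_succ', mul_smul, ih, OnePoint.smul_some_eq_ite]
    simp [matA]
    ring

theorem isBranch_letter {n k : ℕ} (hn : 3 ≤ n) (hk : 1 ≤ k) :
    IsBranch (tr n) (matA n ^ k * matC) := by
  have ht := two_le_tr hn
  have hk' : (1 : ℝ) ≤ k := by exact_mod_cast hk
  have hkt : 2 ≤ k * tr n := by nlinarith
  refine ⟨fun y => 1 / (k * tr n + 1 - y), fun y hy1 hy2 => ⟨?_, ?_, ?_, fun z hz1 hz2 => ?_⟩⟩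
  · rw [inv_smul_eq_iff, mul_smul, OnePoint.smul_some_eq_ite]
    have h0 : k * tr n + 1 - y ≠ 0 := by nlinarith
    simp only [matC, Matrix.GeneralLinearGroup.mkOfDetNeZero]
    simp only [Matrix.unitOfDetInvertible, Matrix.GeneralLinearGroup.mk'] at *
    simp [h0, matA_pow_smul, mu_eq]
    field_simp
    ring
  · have : 0 < k * tr n + 1 - y := by linarith
    positivity
  · rw [div_le_div_iff₀ (by linarith) (by norm_num)]
    linarith
  · have h1 : 2 ≤ k * tr n + 1 - y := by linarith
    have h2 : 2 ≤ k * tr n + 1 - z := by linarith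
    constructor
    · exact one_div_lt_one_div_of_lt (by linarith) (by linarith)
    · rw [div_sub_div _ _ (by linarith) (by linarith), div_le_div_iff₀ (by positivity) (by norm_num)]
      nlinarith [mul_le_mul h1 h2 (by norm_num) (by linarith)]

theorem isBranch_rightMatrix {n k : ℕ} (hn : 3 ≤ n) (hk : 1 ≤ k) (v : List ℕ) :
    rightMatrix n k v = 1 ∨ IsBranch (tr n) (rightMatrix n k v) := by
  have ht := two_le_tr hn
  have hp : ∀ j c : ℕ, 1 ≤ j → (matA n ^ j * matC) ^ c = 1 ∨
      IsBranch (tr n) ((matA n ^ j * matC) ^ c) := by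
    intro j c hj
    rcases Nat.eq_zero_or_pos c with rfl | hc
    · left; simp
    · right; exact (isBranch_letter hn hj).pow ht hc
  have hm : ∀ M N : GL (Fin 2) ℝ, (M = 1 ∨ IsBranch (tr n) M) → (N = 1 ∨ IsBranch (tr n) N) →
      (M * N = 1 ∨ IsBranch (tr n) (M * N)) := by
    rintro M N (rfl | hM) (rfl | hN)
    · left; simp
    · right; simpa using hN
    · right; simpa using hM
    · right; exact hM.mul ht hN
  induction v using rightMatrix.induct with
  | case1 => left; rfl
  | case2 c => exact hp k c hk
  | case3 c d v ih =>
    exact hm _ _ (hm _ _ ih (hp (k + 1) d (by omega))) (hp k c hk)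

theorem isBranch_rightMatrix_cons {n k : ℕ} (hn : 3 ≤ n) (hk : 1 ≤ k) (c : ℕ) (hc : 1 ≤ c)
    (v : List ℕ) : IsBranch (tr n) (rightMatrix n k (c :: v)) := by
  have ht := two_le_tr hn
  have h0 := (isBranch_letter hn hk).pow ht hc
  rcases v with _ | ⟨d, v⟩
  · exact h0
  · have key : ∀ M : GL (Fin 2) ℝ, (M = 1 ∨ IsBranch (tr n) M) →
        IsBranch (tr n) (M * (matA n ^ k * matC) ^ c) := by
      rintro M (rfl | hM)
      · simpa using h0
      · exact hM.mul ht h0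
    apply key
    rcases Nat.eq_zero_or_pos d with rfl | hd
    · simpa using isBranch_rightMatrix hn hk v
    · right
      have h1 := (isBranch_letter hn (k := k + 1) (by omega)).pow ht hd
      rcases isBranch_rightMatrix hn hk v with h | h
      · rw [h]; simpa using h1
      · exact h.mul ht h1

theorem theta_head {q : ℤ} {u v : List ℕ} (h : Theta q u v) :
    ∃ c v₁, 1 ≤ c ∧ v = c :: v₁ := by
  induction h with
  | succ c hc => exact ⟨c + 1, [], by omega, rfl⟩
  | one q hq => exact ⟨1, [q, 1], le_rfl, rfl⟩
  | single q c hc => exact ⟨c, _, by omega, rfl⟩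
  | step p q u v v'' h hv ih =>
    obtain ⟨c, v₁, hc, rfl⟩ := ih
    exact ⟨c, _, hc, rfl⟩

theorem words_head {v : List ℕ} (hv : v ∈ words) : ∃ c v₁, 1 ≤ c ∧ v = c :: v₁ := by
  rcases Relation.ReflTransGen.cases_tail hv with h | ⟨u, -, q, h⟩
  · exact ⟨1, [], le_rfl, h⟩
  · exact theta_head h

/-- An increasing-type contraction of `[0, t]` has exactly one fixed point `α t`. -/
theorem exists_fixed {t : ℝ} (ht : 2 ≤ t) (f : ℝ → ℝ)
    (hf : ∀ x ∈ Set.Icc (0 : ℝ) t, 0 < f x ∧ f x ≤ 1 / 2)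
    (hc : ∀ x ∈ Set.Icc (0 : ℝ) t, ∀ y ∈ Set.Icc (0 : ℝ) t, x < y →
      f x < f y ∧ f y - f x ≤ (y - x) / 2) :
    ∃ x ∈ Set.Icc (0 : ℝ) t, f x = x ∧
      (∀ y ∈ Set.Icc (0 : ℝ) t, f y = y → y = x) ∧
      (∀ y ∈ Set.Icc (0 : ℝ) t, y < f y → y < x) := by
  have hlip : LipschitzOnWith 1 f (Set.Icc 0 t) := by
    apply LipschitzOnWith.of_dist_le_mul
    intro x hx y hy
    rw [Real.dist_eq, Real.dist_eq, NNReal.coe_one, one_mul]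
    rcases lt_trichotomy x y with h | h | h
    · have := hc x hx y hy h
      rw [abs_sub_comm, abs_sub_comm x, abs_of_pos (by linarith), abs_of_pos (by linarith)]
      linarith
    · simp [h]
    · have := hc y hy x hx h
      rw [abs_of_pos (by linarith), abs_of_pos (by linarith)]
      linarith
  have h0 := hf 0 ⟨le_rfl, by linarith⟩
  have h1 := hf t ⟨by linarith, le_rfl⟩
  obtain ⟨x, hx, hx0⟩ := intermediate_value_Icc (f := fun x => x - f x) (by linarith : (0 : ℝ) ≤ t)
    (continuousOn_id.sub hlip.continuousOn) (show (0 : ℝ) ∈ Set.Icc _ _ from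
      ⟨by linarith, by linarith⟩)
  have hx0' : x - f x = 0 := hx0
  refine ⟨x, hx, by linarith, fun y hy hfy => ?_, fun y hy hfy => ?_⟩
  · rcases lt_trichotomy x y with h | h | h
    · have := (hc x hx y hy h).2; linarith
    · exact h.symm
    · have := (hc y hy x hx h).2; linarith
  · rcases lt_trichotomy x y with h | h | h
    · have := (hc x hx y hy h).2; linarith
    · subst h; linarith
    · exact h

/-- The endpoints `ζ_{k,v} < η_{k,v}` of `𝒥_{k,v}` exist and are unique in `[0, 1]`. -/
theorem syncInterval_eq_Ico {n k : ℕ} (hn : 3 ≤ n) (hk : 1 ≤ k) {v : List ℕ} (hv : v ∈ words) :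
    ∃ ζ η : ℝ, ζ < η ∧ (∀ x, IsZeta n k v x ↔ x = ζ) ∧ (∀ x, IsEta n k v x ↔ x = η) ∧
      syncInterval n k v = Set.Ico ζ η := by
  have ht := two_le_tr hn
  have ht0 : 0 < tr n := by linarith
  obtain ⟨g, hg⟩ : IsBranch (tr n) (rightMatrix n k v) := by
    obtain ⟨c, v₁, hc, rfl⟩ := words_head hv
    exact isBranch_rightMatrix_cons hn hk c hc v₁
  set t := tr n with htdef
  have hs : ∀ x : ℝ, 0 ≤ x → -t ≤ x / (1 + t * x) ∧ x / (1 + t * x) ≤ 1 / 2 := by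
    intro x hx
    have h1 : 0 < 1 + t * x := by positivity
    refine ⟨?_, ?_⟩
    · have : 0 ≤ x / (1 + t * x) := by positivity
      linarith
    · rw [div_le_div_iff₀ h1 (by norm_num)]; nlinarith
  obtain ⟨x, hx, hx1, hx2, -⟩ := exists_fixed ht (fun x => g (x - t))
    (fun x hx => by
      obtain ⟨-, a, b, -⟩ := hg (x - t) (by linarith [hx.1]) (by linarith [hx.2])
      exact ⟨a, b⟩)
    (fun x hx y hy hxy => by
      obtain ⟨-, -, -, a⟩ := hg (x - t) (by linarith [hx.1]) (by linarith [hx.2])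
      obtain ⟨b, c⟩ := a (y - t) (by linarith) (by linarith [hy.2])
      exact ⟨b, by linarith⟩)
  obtain ⟨y, hy, hy1, hy2, hy3⟩ := exists_fixed ht (fun x => g (x / (1 + t * x)))
    (fun x hx => by
      obtain ⟨-, a, b, -⟩ := hg _ (hs x hx.1).1 (hs x hx.1).2
      exact ⟨a, b⟩)
    (fun x hx y hy hxy => by
      obtain ⟨-, -, -, a⟩ := hg _ (hs x hx.1).1 (hs x hx.1).2
      have h1 : 0 < 1 + t * x := by have := hx.1; positivity
      have h2 : 0 < 1 + t * y := by have := hy.1; positivity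
      have h3 : 1 ≤ (1 + t * y) * (1 + t * x) := by
        nlinarith [mul_nonneg ht0.le hx.1, mul_nonneg ht0.le hy.1,
          mul_nonneg (mul_nonneg ht0.le hx.1) (mul_nonneg ht0.le hy.1)]
      have h4 : y / (1 + t * y) - x / (1 + t * x) = (y - x) / ((1 + t * y) * (1 + t * x)) := by
        rw [div_sub_div _ _ h2.ne' h1.ne']
        congr 1
        ring
      have h5 : 0 < y / (1 + t * y) - x / (1 + t * x) := by
        rw [h4]; exact div_pos (by linarith) (by positivity)
      have h6 : y / (1 + t * y) - x / (1 + t * x) ≤ y - x := by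
        rw [h4]; exact div_le_self (by linarith) h3
      obtain ⟨b, c⟩ := a (y / (1 + t * y)) (by linarith) (hs y hy.1).2
      exact ⟨b, by linarith⟩)
  have hxy : x < y := by
    apply hy3 x hx
    have h1 : x - t < x / (1 + t * x) ∨ x - t = x / (1 + t * x) := by
      left
      have hx' : x ≤ 1 / 2 := by
        obtain ⟨-, -, b, -⟩ := hg (x - t) (by linarith [hx.1]) (by linarith [hx.2])
        linarith
      have : 0 ≤ x / (1 + t * x) := by have := hx.1; positivity
      linarith
    obtain ⟨-, -, -, a⟩ := hg (x - t) (by linarith [hx.1]) (by linarith [hx.2])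
    rcases h1 with h1 | h1
    · have := (a _ h1 (hs x hx.1).2).1
      linarith
    · have hx' : x ≤ 1 / 2 := by
        obtain ⟨-, -, b, -⟩ := hg (x - t) (by linarith [hx.1]) (by linarith [hx.2])
        linarith
      have : 0 ≤ x / (1 + t * x) := by have := hx.1; positivity
      linarith
  have memt : ∀ a : ℝ, a ∈ Set.Icc (0 : ℝ) 1 ↔ a * t ∈ Set.Icc (0 : ℝ) t := by
    intro a
    constructor
    · rintro ⟨h1, h2⟩; exact ⟨by positivity, by nlinarith⟩
    · rintro ⟨h1, h2⟩
      exact ⟨nonneg_of_mul_nonneg_left h1 ht0, by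
        by_contra h
        push Not at h
        nlinarith⟩
  have hz : ∀ a, IsZeta n k v a ↔ a = x / t := by
    intro a
    rw [IsZeta, rightEnd, leftEnd, ← eq_inv_smul_iff, memt, eq_div_iff ht0.ne', ← htdef]
    have hfac : ∀ a : ℝ, (a - 1) * t = a * t - t := fun a => by ring
    constructor
    · rintro ⟨h1, h2⟩
      rw [hfac, (hg (a * t - t) (by linarith [h1.1]) (by linarith [h1.2])).1,
        OnePoint.coe_eq_coe] at h2
      exact hx2 _ h1 h2.symm
    · intro h
      rw [hfac, h]
      refine ⟨hx, ?_⟩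
      rw [(hg (x - t) (by linarith [hx.1]) (by linarith [hx.2])).1, OnePoint.coe_eq_coe]
      exact hx1.symm
  have hpar : ∀ z : ℝ, 0 ≤ z → (matC⁻¹ * matA n * matC) • ((z / (1 + t * z) : ℝ) : OnePoint ℝ) =
      (z : OnePoint ℝ) := by
    intro z hz0
    have hd : 0 < 1 + t * z := by positivity
    have e : matC⁻¹ * matA n * matC =
        Matrix.GeneralLinearGroup.mkOfDetNeZero !![1, 0; -t, 1] (by simp [Matrix.det_fin_two]) := by
      rw [mul_assoc, inv_mul_eq_iff_eq_mul]
      ext i j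
      fin_cases i <;> fin_cases j <;>
        simp [matC, matA, mu_eq, Matrix.GeneralLinearGroup.mkOfDetNeZero, Matrix.mul_apply,
          Fin.sum_univ_two, ← htdef]
    have h1 : -t * (z / (1 + t * z)) + 1 = 1 / (1 + t * z) := by
      field_simp
      ring
    have h2 : -t * (z / (1 + t * z)) + 1 ≠ 0 := by rw [h1]; positivity
    rw [e, OnePoint.smul_some_eq_ite]
    have : (z / (1 + t * z)) / (-t * (z / (1 + t * z)) + 1) = z := by
      rw [h1]
      field_simp
    simp only [Matrix.GeneralLinearGroup.mkOfDetNeZero]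
    simpa [h2, ← neg_mul] using this
  have he : ∀ a, IsEta n k v a ↔ a = y / t := by
    intro a
    rw [IsEta, rightEnd, memt, eq_div_iff ht0.ne', ← htdef]
    have key : ∀ z : ℝ, z ∈ Set.Icc (0 : ℝ) t → ((z : OnePoint ℝ) =
        (matC⁻¹ * matA n * matC * rightMatrix n k v) • (z : OnePoint ℝ) ↔
          g (z / (1 + t * z)) = z) := by
      intro z hz
      conv_lhs => lhs; rw [← hpar z hz.1]
      rw [mul_smul (matC⁻¹ * matA n * matC), smul_left_cancel_iff, ← inv_smul_eq_iff,
        (hg _ (hs z hz.1).1 (hs z hz.1).2).1, OnePoint.coe_eq_coe]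
    constructor
    · rintro ⟨h1, h2⟩
      exact hy2 _ h1 ((key _ h1).1 h2)
    · intro h
      rw [h]
      exact ⟨hy, (key _ hy).2 hy1⟩
  refine ⟨x / t, y / t, by gcongr, hz, he, ?_⟩
  ext a
  simp [syncInterval, hz, he]

end AlphaCF

namespace AlphaCF

/-! ### Words in two letters -/

/-! Put `r = α t`, so that `𝕀_α = [r - t, r)`. Read `v` as a two-letter word, `true` standing for
the digit `k` and `false` for `k + 1`. The point `x = R_{k,v} • r` is the one whose inverse branch
along the whole word takes the value `r`, and the inverse branch along a suffix of the word is a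
point of the right orbit. A larger digit gives a smaller inverse branch, so inequalities between
these points reduce to comparing suffixes lexicographically with `false < true`.

The condition `α ∈ 𝒥_{k,v}` yields `r - t ≤ x < r / (1 + t r)` (`exists_branch_eq`). The upper bound
is what the parabolic element needs: `C⁻¹AC` sends `r / (1 + t r)` to `r`. The same number is the
inverse branch at `x` of the word with its first letter lowered, since lowering adds `t` to `1 / r`.
The words of the tree are built so that every nonempty suffix of `v` lies lexicographically above
the lowered word and not above `v` itself (`Extremal`). Hence the right orbit stays in `[r / (1 + t
r), r]` until it reaches `x` (`Extremal.branch_bounds`).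

The left orbit is followed through conjugation by `g = C A`. After its opening `(-1)^{n-2}, -2` it
is at `g⁻¹ • r`, and each block `𝒞` or `𝒟` then acts, through `g⁻¹`, as one digit `k` or `k + 1`
acts on the right. This rests on `A⁻¹C` being elliptic with `(A⁻¹C)^n = -1`, which also gives the
identity for `L_{k,v}`. Inside a block the powers of `A⁻¹C` are explicit in sines, so one sign
condition controls a whole run of digits `-1`. The bounds on the right orbit are those that keep all
intermediate left points in `𝕀_α`. The closing `(-1)^{n-2}` takes `g⁻¹ • x` to `C⁻¹AC • x`. The next
step merges the orbits: after `C` the two points differ by `A`, and both are outside `𝕀_α` or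
coincide. -/

/-- The two-letter word `b ^ c₁ (¬b) ^ c₂ b ^ c₃ ⋯` of a list of exponents. -/
def letters : Bool → List ℕ → List Bool
  | _, [] => []
  | b, c :: v => List.replicate c b ++ letters (!b) v

theorem letters_append (b : Bool) (u w : List ℕ) :
    letters b (u ++ w) = letters b u ++ letters (if Even u.length then b else !b) w := by
  induction u generalizing b with
  | nil => simp [letters]
  | cons c u ih =>
    simp only [List.cons_append, letters, ih, List.append_assoc, List.length_cons,
      Nat.even_add_one]
    by_cases h : Even u.length <;> simp [h]

theorem letters_append_even (b : Bool) {u : List ℕ} (hu : Even u.length) (w : List ℕ) :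
    letters b (u ++ w) = letters b u ++ letters b w := by
  rw [letters_append, if_pos hu]

theorem letters_append_odd (b : Bool) {u : List ℕ} (hu : Odd u.length) (w : List ℕ) :
    letters b (u ++ w) = letters b u ++ letters (!b) w := by
  rw [letters_append, if_neg (Nat.not_even_iff_odd.2 hu)]

theorem listPow_zero {X : Type*} (z : List X) : listPow z 0 = [] := rfl

theorem listPow_succ {X : Type*} (z : List X) (q : ℕ) : listPow z (q + 1) = z ++ listPow z q := by
  simp [listPow, List.replicate_succ]

theorem listPow_succ' {X : Type*} (z : List X) (q : ℕ) : listPow z (q + 1) = listPow z q ++ z := by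
  simp [listPow, List.replicate_succ']

theorem listPow_add {X : Type*} (z : List X) (p q : ℕ) :
    listPow z (p + q) = listPow z p ++ listPow z q := by
  simp [listPow, ← List.replicate_append_replicate]

theorem even_length_listPow {X : Type*} {z : List X} (hz : Even z.length) (q : ℕ) :
    Even (listPow z q).length := by
  simp [listPow, hz]

theorem letters_listPow (b : Bool) {u : List ℕ} (hu : Even u.length) (q : ℕ) :
    letters b (listPow u q) = listPow (letters b u) q := by
  induction q with
  | zero => rfl
  | succ q ih => rw [listPow_succ, letters_append_even b hu, ih, listPow_succ]

/-- The word with its first letter replaced by `false`. -/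
def lowerHead : List Bool → List Bool
  | [] => []
  | _ :: l => false :: l

/-- Read in two letters, the two cases of `v'` become one operation, changing the first letter from
`true` to `false`. The reading of `v'` must start with `false`. -/
theorem letters_prime {c d : ℕ} (hc : 1 ≤ c) (v : List ℕ) :
    letters false (prime (c :: d :: v)) = lowerHead (letters true (c :: d :: v)) := by
  obtain ⟨c, rfl⟩ := Nat.exists_eq_add_of_le' hc
  rcases c with _ | c
  · simp [prime, letters, lowerHead, List.replicate_succ]
  · simp [prime, letters, lowerHead, List.replicate_succ]

theorem even_length_prime {c d : ℕ} {v : List ℕ} (h : Odd (c :: d :: v).length) :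
    Even (prime (c :: d :: v)).length := by
  unfold prime
  split <;> simp_all [Nat.odd_add_one]

/-- The pairs (word, final factor) which the operators `Θ_q` generate, in two-letter form. -/
inductive WordState : List Bool → List Bool → Prop
  | root : WordState [true] [true]
  | step {v z : List Bool} (q : ℕ) (h : WordState v z) :
      WordState (v ++ (listPow (lowerHead v) q ++ z)) (listPow (lowerHead v) q ++ z)

theorem wordState_replicate (c : ℕ) : WordState (List.replicate (c + 1) true) [true] := by
  induction c with
  | zero => exact .root
  | succ c ih => simpa [listPow_zero, List.replicate_succ' (n := c + 1)] using ih.step 0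

/-- In two letters every `Θ_q` is the single operation `v z' ↦ v (v')^q z`. The second clause
records that the tail added by the previous operator is exactly the final factor `z`, together with
the parities that decide which letter each part begins with; the induction needs both. -/
theorem Theta.wordState {q : ℤ} {u v : List ℕ} (h : Theta q u v) :
    (∃ z, WordState (letters true v) z) ∧
      (0 ≤ q → ∃ w, v = u ++ w ∧ Odd u.length ∧ Even w.length ∧ w ≠ [] ∧
        WordState (letters true v) (letters false w)) := by
  induction h with
  | succ c hc =>
    refine ⟨⟨_, by simpa [letters] using wordState_replicate c⟩, fun h => ?_⟩
    norm_num at h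
  | one q hq =>
    have h := WordState.root.step q
    have e : ∀ q, listPow [false] q = List.replicate q false := fun q => by simp [listPow]
    have h' : WordState (letters true [1, q, 1]) (letters false [q, 1]) := by
      simpa [letters, lowerHead, e] using h
    exact ⟨⟨_, h'⟩, fun _ => ⟨[q, 1], rfl, by decide, by simp, by simp, h'⟩⟩
  | single q c hc =>
    obtain ⟨c, rfl⟩ := Nat.exists_eq_add_of_lt hc
    -- The exponent is `q + 1`: the ending `1 c` of `Θ_q(c)` reads `false true^c`, which is one more
    -- lowered copy of `true^c` followed by the final factor `true`.
    have h := (wordState_replicate (1 + c)).step (q + 1)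
    have hev : Even (List.length [1, 1 + c + 1 - 1]) := by simp
    have h' : WordState (letters true ([1 + c + 1] ++
        (listPow [1, 1 + c + 1 - 1] q ++ [1, 1 + c + 1])))
        (letters false (listPow [1, 1 + c + 1 - 1] q ++ [1, 1 + c + 1])) := by
      rw [letters_append_odd true (by simp), Bool.not_true, letters_append_even false
        (even_length_listPow hev q), letters_listPow false hev]
      rw [listPow_succ'] at h
      simpa [letters, lowerHead, List.replicate_succ, ← List.replicate_succ',
        List.replicate_succ' (n := 1 + c)] using h
    rw [← List.append_assoc] at h'
    exact ⟨⟨_, h'⟩, fun _ => ⟨_, List.append_assoc _ _ _, by simp,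
      by simpa [Nat.even_add] using even_length_listPow hev q, by simp, h'⟩⟩
  | step p q u v v'' h hv ih =>
    obtain ⟨w, hw, hu, hwe, hw0, hs⟩ := ih.2 (by positivity)
    obtain rfl : v'' = w := by
      rw [hv] at hw; exact List.append_cancel_left hw
    have hvo : Odd v.length := by rw [hv, List.length_append]; exact hu.add_even hwe
    obtain ⟨c, v₁, hc, rfl⟩ := theta_head h
    obtain ⟨d, v₂, rfl⟩ : ∃ d v₂, v₁ = d :: v₂ := by
      rcases v₁ with _ | ⟨d, v₂⟩
      · have := congrArg List.length hv
        have h1 := hu.pos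
        have h2 := List.length_pos_of_ne_nil hw0
        simp at this
        omega
      · exact ⟨d, v₂, rfl⟩
    have hpe := even_length_prime hvo
    have h' := hs.step q
    rw [← letters_prime hc, ← letters_listPow false hpe,
      ← letters_append_even false (even_length_listPow hpe q)] at h'
    have e := letters_append_odd true hvo (listPow (prime (c :: d :: v₂)) q ++ v'')
    rw [Bool.not_true] at e
    rw [← e, ← List.append_assoc] at h'
    exact ⟨⟨_, h'⟩, fun _ => ⟨_, List.append_assoc _ _ _, hvo,
      by rw [List.length_append]; exact (even_length_listPow hpe q).add hwe, by simp [hw0], h'⟩⟩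

theorem exists_wordState {v : List ℕ} (hv : v ∈ words) : ∃ z, WordState (letters true v) z := by
  rcases Relation.ReflTransGen.cases_tail hv with h | ⟨u, -, q, h⟩
  · exact ⟨_, by rw [h]; exact .root⟩
  · exact h.wordState.1

/-- `a` and `b` differ somewhere, and `a` has `false` at the first difference. -/
def LexLT (a b : List Bool) : Prop :=
  ∃ p a' b', a = p ++ false :: a' ∧ b = p ++ true :: b'

/-- `a` precedes `b` at the first difference, or `a` is a prefix of `b`. -/
def LexLE (a b : List Bool) : Prop := LexLT a b ∨ a <+: b

theorem LexLT.append {a b : List Bool} (h : LexLT a b) (x y : List Bool) :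
    LexLT (a ++ x) (b ++ y) := by
  obtain ⟨p, a', b', rfl, rfl⟩ := h
  exact ⟨p, a' ++ x, b' ++ y, by simp, by simp⟩

theorem LexLT.append_left {a b : List Bool} (h : LexLT a b) (p : List Bool) :
    LexLT (p ++ a) (p ++ b) := by
  obtain ⟨p', a', b', rfl, rfl⟩ := h
  exact ⟨p ++ p', a', b', by simp, by simp⟩

theorem LexLE.append {a b : List Bool} (h : LexLE a b) (y : List Bool) : LexLE a (b ++ y) := by
  rcases h with h | h
  · left; simpa using h.append [] y
  · right; exact h.trans (List.prefix_append _ _)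

theorem LexLE.append_left {a b : List Bool} (h : LexLE a b) (p : List Bool) :
    LexLE (p ++ a) (p ++ b) := by
  rcases h with h | h
  · exact .inl (h.append_left p)
  · exact .inr ((List.prefix_append_right_inj p).2 h)

/-! ### Lexicographic extremality of the words under suffixes -/

theorem suffix_append_cases {X : Type*} {y a b : List X} (h : y <:+ a ++ b) :
    y <:+ b ∨ ∃ y₀, y₀ ≠ [] ∧ y₀ <:+ a ∧ y = y₀ ++ b := by
  obtain ⟨x, hx⟩ := h
  rcases List.append_eq_append_iff.1 hx with ⟨c, rfl, rfl⟩ | ⟨c, rfl, rfl⟩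
  · rcases c with _ | ⟨e, c⟩
    · left; simp
    · right; exact ⟨e :: c, by simp, List.suffix_append _ _, rfl⟩
  · left; exact List.suffix_append _ _

theorem suffix_listPow_append_cases {X : Type*} {y u z : List X} {q : ℕ}
    (h : y <:+ listPow u q ++ z) :
    y <:+ z ∨ ∃ i < q, ∃ y₀, y₀ ≠ [] ∧ y₀ <:+ u ∧ y = y₀ ++ (listPow u i ++ z) := by
  induction q with
  | zero => left; simpa [listPow_zero] using h
  | succ q ih =>
    rw [listPow_succ, List.append_assoc] at h
    rcases suffix_append_cases h with h | ⟨y₀, h0, h1, h2⟩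
    · rcases ih h with h | ⟨i, hi, h⟩
      · exact .inl h
      · exact .inr ⟨i, by omega, h⟩
    · exact .inr ⟨q, by omega, y₀, h0, h1, h2⟩

/-- The order properties of a word `v` with final factor `z`. -/
structure Extremal (v z : List Bool) : Prop where
  head : ∃ l, v = true :: l
  ne_nil : z ≠ []
  suffix : z <:+ v
  lower_lt : ∀ y, y <:+ v → y ≠ [] → LexLT (lowerHead v) y
  le_self : ∀ y, y <:+ v → y ≠ [] → LexLE y v
  factor_le : ∀ y, y <:+ v → y ≠ [] → LexLE z y

/-- A suffix of `v u^q z`, with `u` the lowered word, is a suffix of `z`, a product `u^i z`, or `y₀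
u^i z` with `y₀` a suffix of `v`, and each is compared using the old properties. The property
`factor_le` is carried along for one case: when `v = y₀ y₂`, comparing `y₀ z` with `v` comes down to
comparing `z` with `y₂`. -/
theorem Extremal.step {v z : List Bool} (h : Extremal v z) (q : ℕ) :
    Extremal (v ++ (listPow (lowerHead v) q ++ z)) (listPow (lowerHead v) q ++ z) := by
  obtain ⟨l, hl⟩ := h.head
  set u := lowerHead v with hu
  have hu' : u = false :: l := by rw [hu, hl]; rfl
  have hz := h.lower_lt z h.suffix h.ne_nil
  have hlow : lowerHead (v ++ (listPow u q ++ z)) = u ++ (listPow u q ++ z) := by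
    rw [hu', hl]; rfl
  have husuf : ∀ y, y <:+ u → y = u ∨ (y <:+ v ∧ y ≠ v) := by
    intro y hy
    rw [hu', List.suffix_cons_iff] at hy
    rcases hy with hy | hy
    · exact .inl (hy.trans hu'.symm)
    · right
      refine ⟨hy.trans (hl ▸ List.suffix_cons _ _), fun e => ?_⟩
      have := hy.length_le
      rw [e, hl] at this
      simp at this
  have hcases : ∀ y, y <:+ v ++ (listPow u q ++ z) → y ≠ [] →
      (y <:+ v ∧ y <:+ z) ∨ (∃ i ≤ q, 1 ≤ i ∧ y = listPow u i ++ z) ∨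
        ∃ y₀ i, y₀ ≠ [] ∧ y₀ <:+ v ∧ i ≤ q ∧ (y₀ = v → i = q) ∧
          y = y₀ ++ (listPow u i ++ z) := by
    intro y hy hy0
    rcases suffix_append_cases hy with hy | ⟨y₀, h0, h1, h2⟩
    · rcases suffix_listPow_append_cases hy with hy | ⟨i, hi, y₀, h0, h1, h2⟩
      · exact .inl ⟨hy.trans h.suffix, hy⟩
      · rcases husuf y₀ h1 with e | ⟨e1, e2⟩
        · refine .inr (.inl ⟨i + 1, hi, by omega, ?_⟩)
          rw [h2, e, listPow_succ, List.append_assoc]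
        · exact .inr (.inr ⟨y₀, i, h0, e1, hi.le, fun e => absurd e e2, h2⟩)
    · exact .inr (.inr ⟨y₀, q, h0, h1, le_rfl, fun _ => rfl, h2⟩)
  -- Since `u < z`, inserting further copies of `u` before `z` lowers the word.
  have hpow : ∀ i j, LexLT (listPow u (i + 1 + j) ++ z) (listPow u j ++ z) := by
    intro i j
    have e : listPow u (i + 1 + j) ++ z = listPow u j ++ (u ++ (listPow u i ++ z)) := by
      rw [show i + 1 + j = j + (i + 1) by omega, listPow_add, listPow_succ]
      simp only [List.append_assoc]
    rw [e]
    apply LexLT.append_left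
    simpa using hz.append (listPow u i ++ z) []
  refine ⟨⟨_, by rw [hl]; rfl⟩, by simp [h.ne_nil], List.suffix_append _ _, ?_, ?_, ?_⟩
  · intro y hy hy0
    rw [hlow]
    rcases hcases y hy hy0 with ⟨h1, -⟩ | ⟨i, hi, -, rfl⟩ | ⟨y₀, i, h0, h1, hi, -, rfl⟩
    · simpa using (h.lower_lt y h1 hy0).append (listPow u q ++ z) []
    · have := hpow (q - i) i
      rw [show q - i + 1 + i = q + 1 by omega, listPow_succ, List.append_assoc] at this
      exact this
    · exact (h.lower_lt y₀ h1 h0).append _ _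
  · intro y hy hy0
    rcases hcases y hy hy0 with ⟨h1, -⟩ | ⟨i, hi, hi1, rfl⟩ | ⟨y₀, i, h0, h1, hi, hiq, rfl⟩
    · exact (h.le_self y h1 hy0).append _
    · left
      obtain ⟨i, rfl⟩ := Nat.exists_eq_add_of_le' hi1
      rw [listPow_succ, hu', hl]
      exact ⟨[], _, _, rfl, rfl⟩
    · rcases h.le_self y₀ h1 h0 with h2 | ⟨y₂, h2⟩
      · exact .inl (h2.append _ _)
      · rw [← h2, List.append_assoc]
        apply LexLE.append_left
        -- An empty `y₂` means `y₀ = v`, so the suffix is the whole new word.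
        rcases eq_or_ne y₂ [] with rfl | hy₂
        · rw [hiq (by simpa using h2)]
          right; simp
        · have hs : y₂ <:+ v := ⟨y₀, h2⟩
          rcases i with _ | i
          · exact (h.factor_le y₂ hs hy₂).append _
          · left
            rw [listPow_succ, List.append_assoc]
            exact (h.lower_lt y₂ hs hy₂).append _ _
  · intro y hy hy0
    rcases hcases y hy hy0 with ⟨h1, -⟩ | ⟨i, hi, -, rfl⟩ | ⟨y₀, i, h0, h1, hi, -, rfl⟩
    · rcases q with _ | q
      · exact h.factor_le y h1 hy0
      · left
        rw [listPow_succ, List.append_assoc]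
        simpa using (h.lower_lt y h1 hy0).append (listPow u q ++ z) []
    · rcases hi.eq_or_lt with rfl | hi
      · right; simp
      · left
        have := hpow (q - i - 1) i
        rwa [show q - i - 1 + 1 + i = q by omega] at this
    · rcases q with _ | q
      · obtain rfl : i = 0 := by omega
        exact (h.factor_le y₀ h1 h0).append _
      · left
        rw [listPow_succ, List.append_assoc]
        exact (h.lower_lt y₀ h1 h0).append _ _

theorem WordState.extremal {v z : List Bool} (h : WordState v z) : Extremal v z := by
  induction h with
  | root =>
    have hy : ∀ y : List Bool, y <:+ [true] → y ≠ [] → y = [true] := by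
      intro y h h0
      rcases List.suffix_cons_iff.1 h with h | h
      · exact h
      · exact absurd (List.suffix_nil.1 h) h0
    refine ⟨⟨[], rfl⟩, by simp, List.suffix_rfl, ?_, ?_, ?_⟩ <;> intro y h h0 <;>
      rw [hy y h h0]
    · exact ⟨[], [], [], rfl, rfl⟩
    · exact .inr List.prefix_rfl
    · exact .inr List.prefix_rfl
  | step q _ ih => exact ih.step q

/-! ### Inverse branches -/

/-- The simplified digit of a letter: `k` or `k + 1`. -/
def digit (k : ℕ) (b : Bool) : ℕ := if b then k else k + 1

/-- The inverse of `x ↦ A ^ a C • x`, composed along the digits `a` of a two-letter word. -/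
noncomputable def branch (t : ℝ) (k : ℕ) : List Bool → ℝ → ℝ
  | [], x => x
  | b :: l, x => 1 / (digit k b * t + 1 - branch t k l x)

section

variable {t : ℝ} {k : ℕ}

theorem branch_append (a b : List Bool) (x : ℝ) :
    branch t k (a ++ b) x = branch t k a (branch t k b x) := by
  induction a with
  | nil => rfl
  | cons c a ih => simp [branch, ih]

theorem two_le_digit_mul (ht : 2 ≤ t) (hk : 1 ≤ k) (b : Bool) : 2 ≤ digit k b * t := by
  have h : (1 : ℝ) ≤ digit k b := by
    rcases b <;> simp [digit]
    exact_mod_cast hk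
  nlinarith

theorem branch_mem (ht : 2 ≤ t) (hk : 1 ≤ k) (l : List Bool) {x : ℝ} (h1 : -t ≤ x)
    (h2 : x ≤ 1 / 2) :
    -t ≤ branch t k l x ∧ branch t k l x ≤ 1 / 2 ∧ (l ≠ [] → 0 < branch t k l x) := by
  induction l with
  | nil => exact ⟨h1, h2, fun h => absurd rfl h⟩
  | cons b l ih =>
    obtain ⟨-, h3, -⟩ := ih
    have h4 := two_le_digit_mul ht hk b
    have h5 : 0 < digit k b * t + 1 - branch t k l x := by linarith
    have h6 : 0 < branch t k (b :: l) x := by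
      rw [branch]; positivity
    refine ⟨by linarith, ?_, fun _ => h6⟩
    rw [branch, div_le_div_iff₀ h5 (by norm_num)]
    linarith

theorem branch_mono (ht : 2 ≤ t) (hk : 1 ≤ k) (l : List Bool) {x y : ℝ} (h1 : -t ≤ x)
    (hxy : x < y) (h2 : y ≤ 1 / 2) :
    branch t k l x < branch t k l y ∧ branch t k l y - branch t k l x ≤ y - x := by
  induction l with
  | nil => exact ⟨hxy, le_rfl⟩
  | cons b l ih =>
    have hx := (branch_mem ht hk l h1 (hxy.le.trans h2)).2.1
    have hy := (branch_mem ht hk l (h1.trans hxy.le) h2).2.1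
    have h4 := two_le_digit_mul ht hk b
    simp only [branch]
    set X := digit k b * t + 1 - branch t k l x with hX
    set Y := digit k b * t + 1 - branch t k l y with hY
    have hX2 : 2 ≤ X := by linarith
    have hY2 : 2 ≤ Y := by linarith
    have hXY : Y < X := by linarith [ih.1]
    refine ⟨one_div_lt_one_div_of_lt (by linarith) hXY, ?_⟩
    have h5 : 1 / Y - 1 / X = (X - Y) / (Y * X) := by
      field_simp
    rw [h5]
    have h6 : (X - Y) / (Y * X) ≤ X - Y := div_le_self (by linarith) (by nlinarith)
    linarith [ih.2]

/-- At the first difference the digits differ by one, which is worth `t` in the denominator; this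
outweighs the tails as long as they differ by less than `t`. The hypothesis `h` is only delicate
when `b` is empty, since its branch is then `x`, possibly as low as `r - t`. -/
theorem branch_lt_of_lexLT (ht : 2 ≤ t) (hk : 1 ≤ k) (p a b : List Bool) {x : ℝ} (h1 : -t ≤ x)
    (h2 : x ≤ 1 / 2) (h : branch t k a x - branch t k b x < t) :
    branch t k (p ++ false :: a) x < branch t k (p ++ true :: b) x := by
  rw [branch_append, branch_append]
  have ha := branch_mem ht hk (false :: a) h1 h2
  have hb := branch_mem ht hk (true :: b) h1 h2
  refine (branch_mono ht hk p ha.1 ?_ hb.2.1).1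
  have hb' := (branch_mem ht hk b h1 h2).2.1
  have h4 := two_le_digit_mul ht hk true
  simp only [branch]
  apply one_div_lt_one_div_of_lt (by linarith)
  simp [digit]
  linarith

/-- The upper bound is comparison of `y` with `v`, whose branch is `r`; the lower bound is
comparison with the lowered word, whose branch is `r / (1 + t r)`. -/
theorem Extremal.branch_bounds {v z : List Bool} (h : Extremal v z) (ht : 2 ≤ t) (hk : 1 ≤ k)
    {x r : ℝ} (hr0 : 0 < r) (hr1 : r ≤ 1 / 2) (h1 : r - t ≤ x) (h2 : x < r / (1 + t * r))
    (hr : branch t k v x = r) {y : List Bool} (hy : y <:+ v) (hy0 : y ≠ []) :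
    r / (1 + t * r) ≤ branch t k y x ∧ branch t k y x ≤ r ∧ (y ≠ v → branch t k y x < r) := by
  have hxr : r / (1 + t * r) ≤ r := div_le_self hr0.le (by nlinarith)
  have hx1 : -t ≤ x := by linarith
  have hx2 : x ≤ 1 / 2 := by linarith
  have hmem := fun l => branch_mem ht hk l hx1 hx2
  obtain ⟨l, hl⟩ := h.head
  have hlow : branch t k (lowerHead v) x = r / (1 + t * r) := by
    rw [← hr, hl]
    have h3 := (hmem l).2.1
    have h4 := two_le_digit_mul ht hk true
    have h5 := two_le_digit_mul ht hk false
    have h6 : digit k true * t + 1 - branch t k l x ≠ 0 := by linarith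
    have h7 : digit k false * t + 1 - branch t k l x ≠ 0 := by linarith
    simp only [lowerHead, branch]
    have h8 : digit k false * t + 1 - branch t k l x =
        digit k true * t + 1 - branch t k l x + t := by
      simp [digit]; ring
    rw [h8] at h7 ⊢
    field_simp
  have hlt : ∀ y, y <:+ v → y ≠ [] → y ≠ v → branch t k y x < r := by
    intro y hy hy0 hyv
    rw [← hr]
    have hlen : y.length < v.length :=
      lt_of_le_of_ne hy.length_le fun e => hyv (hy.eq_of_length e)
    rcases h.le_self y hy hy0 with ⟨p, a, b, rfl, e⟩ | ⟨y₂, e⟩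
    · rw [e]
      apply branch_lt_of_lexLT ht hk p a b hx1 hx2
      -- As `y` is shorter than `v`, the tail of `v` is nonempty and has a positive branch.
      have hb : b ≠ [] := by
        rintro rfl
        rw [e] at hlen
        simp at hlen
      linarith [(hmem b).2.2 hb, (hmem a).2.1]
    · have hy₂ : y₂ ≠ [] := by
        rintro rfl
        simp [← e] at hlen
      rw [← e, branch_append]
      refine (branch_mono ht hk y hx1 ?_ (hmem y₂).2.1).1
      -- When `y` is a prefix of `v`, it remains to see that `x` lies below the branch along `y₂`.
      -- For positive `x` the branch of the lowered word separates them.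
      rcases le_or_gt x 0 with hx | hx
      · linarith [(hmem y₂).2.2 hy₂]
      · refine (h2.trans_eq hlow.symm).trans ?_
        obtain ⟨p, a, b, e1, e2⟩ := h.lower_lt y₂ ⟨y, e⟩ hy₂
        rw [e1, e2]
        apply branch_lt_of_lexLT ht hk p a b hx1 hx2
        have : 0 < branch t k b x := by
          rcases b with _ | ⟨c, b⟩
          · exact hx
          · exact (hmem _).2.2 (by simp)
        linarith [(hmem a).2.1]
  refine ⟨?_, ?_, hlt y hy hy0⟩
  · rw [← hlow]
    obtain ⟨p, a, b, e1, e2⟩ := h.lower_lt y hy hy0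
    rw [e1, e2]
    apply le_of_lt
    apply branch_lt_of_lexLT ht hk p a b hx1 hx2
    rcases b with _ | ⟨c, b⟩
    · have ha : branch t k a x < r := by
        rcases eq_or_ne a [] with rfl | ha
        · exact h2.trans_le hxr
        · have hal : a <:+ l := by
            rw [hl] at e1
            have e3 : false :: l = p ++ false :: a := e1
            rcases p with _ | ⟨c, p⟩
            · simp at e3; rw [e3]
            · simp at e3; rw [e3.2]; exact ⟨p ++ [false], by simp⟩
          refine hlt a (hal.trans (hl ▸ List.suffix_cons _ _)) ha fun e => ?_
          have := hal.length_le
          rw [e, hl] at this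
          simp at this
      simp only [branch]
      linarith
    · linarith [(hmem a).2.1, (hmem (c :: b)).2.2 (by simp)]
  · rcases eq_or_ne y v with rfl | hyv
    · exact hr.le
    · exact (hlt y hy hy0 hyv).le

end

/-! ### Chains of points with prescribed digits -/

/-- `Path t r x ds y`: the maps `x ↦ 1 - 1 / x + d t` with `d` running through `ds` lead from `x`
to `y`, starting in `[r - t, r]` and remaining in `[r - t, r)`. -/
inductive Path (t r : ℝ) : ℝ → List ℤ → ℝ → Prop
  | nil (x : ℝ) : Path t r x [] x
  | cons {x y z : ℝ} {d : ℤ} {ds : List ℤ} (hx : x ≠ 0) (hd : d ≠ 0) (h1 : r - t ≤ x)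
      (h2 : x ≤ r) (hy : y = 1 - 1 / x + d * t) (h3 : r - t ≤ y) (h4 : y < r)
      (h : Path t r y ds z) : Path t r x (d :: ds) z

theorem Path.append {t r x y z : ℝ} {a b : List ℤ} (h : Path t r x a y) (h' : Path t r y b z) :
    Path t r x (a ++ b) z := by
  induction h with
  | nil x => exact h'
  | cons hx hd h1 h2 hy h3 h4 _ ih => exact .cons hx hd h1 h2 hy h3 h4 (ih h')

theorem Path.snoc {t r x y z : ℝ} {ds : List ℤ} (h : Path t r x ds y) {d : ℤ} (hx : y ≠ 0)
    (hd : d ≠ 0) (h1 : r - t ≤ y) (h2 : y ≤ r) (hz : z = 1 - 1 / y + d * t) (h3 : r - t ≤ z)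
    (h4 : z < r) : Path t r x (ds ++ [d]) z :=
  h.append (.cons hx hd h1 h2 hz h3 h4 (.nil z))

/-! ### The elliptic element `A⁻¹ C` -/

/-- The numerator of the `m`-th power of the elliptic map `x ↦ 1 - 1 / x - t`. -/
noncomputable def rotNum (n m : ℕ) (x : ℝ) : ℝ :=
  Real.sin ((m + 1) * (Real.pi / n)) * x + Real.sin (m * (Real.pi / n))

theorem tr_eq (n : ℕ) : tr n = 1 + 2 * Real.cos (Real.pi / n) := by
  rw [tr, mu_eq]

theorem sin_mul_pos {n m : ℕ} (h1 : 1 ≤ m) (h2 : m < n) : 0 < Real.sin (m * (Real.pi / n)) := by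
  have hn : (0 : ℝ) < n := by exact_mod_cast (by omega : 0 < n)
  have hm : (0 : ℝ) < m := by exact_mod_cast h1
  have hmn : (m : ℝ) < n := by exact_mod_cast h2
  have hpi := Real.pi_pos
  apply Real.sin_pos_of_pos_of_lt_pi (by positivity)
  rw [mul_div_assoc', div_lt_iff₀ hn, mul_comm]
  gcongr

theorem sin_add_two_mul (a θ : ℝ) :
    Real.sin ((a + 1 + 1) * θ) = 2 * Real.cos θ * Real.sin ((a + 1) * θ) - Real.sin (a * θ) := by
  have h1 : (a + 1 + 1) * θ = (a + 1) * θ + θ := by ring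
  have h2 : a * θ = (a + 1) * θ - θ := by ring
  rw [h1, h2, Real.sin_add, Real.sin_sub]
  ring

theorem sin_wronskian (a θ : ℝ) :
    Real.sin ((a + 1) * θ) ^ 2 - Real.sin (a * θ) * Real.sin ((a + 1 + 1) * θ) =
      Real.sin θ ^ 2 := by
  have h1 : (a + 1 + 1) * θ = (a + 1) * θ + θ := by ring
  have h2 : a * θ = (a + 1) * θ - θ := by ring
  rw [h1, h2, Real.sin_add, Real.sin_sub]
  have h3 := Real.sin_sq_add_cos_sq θ
  have h4 := Real.sin_sq_add_cos_sq ((a + 1) * θ)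
  linear_combination (Real.sin θ ^ 2) * h4 - Real.sin ((a + 1) * θ) ^ 2 * h3

theorem rotNum_add_two (n m : ℕ) (x : ℝ) :
    rotNum n (m + 2) x = (tr n - 1) * rotNum n (m + 1) x - rotNum n m x := by
  have h1 := sin_add_two_mul m (Real.pi / n)
  have h2 := sin_add_two_mul (m + 1) (Real.pi / n)
  simp only [rotNum, tr_eq]
  push_cast
  rw [show (m : ℝ) + 2 = m + 1 + 1 by ring, h2, h1]
  ring

theorem rotNum_zero (n : ℕ) (x : ℝ) : rotNum n 0 x = Real.sin (Real.pi / n) * x := by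
  simp [rotNum]

theorem rotNum_one (n : ℕ) (x : ℝ) :
    rotNum n 1 x = Real.sin (Real.pi / n) * ((tr n - 1) * x + 1) := by
  have h := sin_add_two_mul 0 (Real.pi / n)
  simp only [zero_add, one_mul, zero_mul, Real.sin_zero] at h
  simp only [rotNum, Nat.cast_one, h, tr_eq, one_mul]
  ring

/-- The Wronskian identity shows that the zero of `rotNum n m` lies to the right of the zero of
`rotNum n (m + 1)`. So negativity at the last index propagates down to all earlier ones. -/
theorem rotNum_neg_of_succ {n m : ℕ} (hm : m + 2 < n) {x : ℝ} (h : rotNum n (m + 1) x < 0) :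
    rotNum n m x < 0 := by
  have h1 := sin_mul_pos (n := n) (m := m + 1) (by omega) (by omega)
  have h2 := sin_mul_pos (n := n) (m := m + 2) (by omega) hm
  have h3 := sin_wronskian m (Real.pi / n)
  simp only [rotNum] at *
  push_cast at *
  rw [show (m : ℝ) + 2 = m + 1 + 1 by ring] at h2
  set a := Real.sin (m * (Real.pi / n))
  set b := Real.sin ((m + 1) * (Real.pi / n))
  set c := Real.sin ((m + 1 + 1) * (Real.pi / n))
  have h4 : c * (b * x + a) = b * (c * x + b) - (b ^ 2 - a * c) := by ring
  have h5 : b * (c * x + b) < 0 := mul_neg_of_pos_of_neg h1 h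
  have h6 : c * (b * x + a) < 0 := by
    rw [h4, h3]
    have := sq_nonneg (Real.sin (Real.pi / n))
    linarith
  exact neg_of_mul_neg_right h6 h2.le

theorem tr_lt_three {n : ℕ} (hn : 3 ≤ n) : tr n < 3 := by
  have hn' : (3 : ℝ) ≤ n := by exact_mod_cast hn
  have hpi := Real.pi_pos
  have h : Real.cos (Real.pi / n) < Real.cos 0 := by
    apply Real.cos_lt_cos_of_nonneg_of_le_pi le_rfl
    · exact div_le_self hpi.le (by linarith)
    · positivity
  rw [Real.cos_zero] at h
  rw [tr_eq]
  linarith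

/-- All the iterates are negative by propagation of the sign, and they increase because `t < 3`
leaves the elliptic map without real fixed points. Hence they cannot leave `[r - t, r)`. -/
theorem exists_path_replicate {n m : ℕ} (hn : 3 ≤ n) (hm : m + 2 ≤ n) {r x : ℝ} (hr : 0 < r)
    (hx : r - tr n ≤ x) (h : rotNum n m x < 0) :
    ∃ y < 0, r - tr n ≤ y ∧ Path (tr n) r x (List.replicate m (-1)) y ∧
      1 - 1 / y - tr n = -rotNum n (m + 1) x / rotNum n m x := by
  have hs : 0 < Real.sin (Real.pi / n) := by
    simpa using sin_mul_pos (n := n) (m := 1) le_rfl (by omega)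
  have ht2 := two_le_tr hn
  have ht3 := tr_lt_three hn
  induction m with
  | zero =>
    have hx0 : x < 0 := by
      rw [rotNum_zero] at h
      exact neg_of_mul_neg_right h hs.le
    refine ⟨x, hx0, hx, .nil x, ?_⟩
    rw [rotNum_zero, rotNum_one, ← mul_neg, mul_div_mul_left _ _ hs.ne']
    have := hx0.ne
    field_simp
    ring
  | succ m ih =>
    have h' := rotNum_neg_of_succ (by omega) h
    obtain ⟨y, hy0, hy, hp, e⟩ := ih (by omega) h'
    have hneg : -rotNum n (m + 1) x / rotNum n m x < 0 :=
      div_neg_of_pos_of_neg (by linarith) h'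
    have hgt : y ≤ 1 - 1 / y - tr n := by
      have : 1 - 1 / y - tr n - y = (y ^ 2 + (tr n - 1) * y + 1) / (-y) := by
        have := hy0.ne
        field_simp
        ring
      have h5 : 0 ≤ (y ^ 2 + (tr n - 1) * y + 1) / (-y) := by
        apply div_nonneg _ (by linarith)
        nlinarith [sq_nonneg (y + 1)]
      linarith
    refine ⟨_, hneg, by rw [← e]; linarith, ?_, ?_⟩
    · rw [List.replicate_succ']
      refine hp.snoc hy0.ne (by norm_num) hy (by linarith) ?_ (by rw [← e]; linarith)
        (by linarith)
      rw [← e]; push_cast; ring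
    · rw [rotNum_add_two]
      have := h.ne
      have := h'.ne
      field_simp
      ring

theorem path_replicate_append {n m : ℕ} (hn : 3 ≤ n) (hm : m + 2 ≤ n) {r x y : ℝ} {d : ℤ}
    (hr : 0 < r) (hd : d ≠ 0) (hx : r - tr n ≤ x) (h : rotNum n m x < 0)
    (hy : y = -rotNum n (m + 1) x / rotNum n m x + (d + 1) * tr n) (h1 : r - tr n ≤ y)
    (h2 : y < r) : Path (tr n) r x (List.replicate m (-1) ++ [d]) y := by
  obtain ⟨z, hz0, hz, hp, e⟩ := exists_path_replicate hn hm hr hx h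
  refine hp.snoc hz0.ne hd hz (by linarith) ?_ h1 h2
  rw [hy, ← e]
  ring

/-! ### Closed forms for the powers `n - 3` to `n - 1` of the elliptic map -/

theorem sin_reflect {n a b : ℕ} (hn : 0 < n) (h : a + b = n) :
    Real.sin (a * (Real.pi / n)) = Real.sin (b * (Real.pi / n)) := by
  rw [← Real.sin_pi_sub]
  congr 1
  have : (n : ℝ) ≠ 0 := by positivity
  subst h
  field_simp
  push_cast
  ring

theorem sin_two_mul_div (n : ℕ) :
    Real.sin (2 * (Real.pi / n)) = Real.sin (Real.pi / n) * (tr n - 1) := by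
  rw [Real.sin_two_mul, tr_eq]; ring

theorem sin_three_mul_div (n : ℕ) :
    Real.sin (3 * (Real.pi / n)) = Real.sin (Real.pi / n) * (tr n ^ 2 - 2 * tr n) := by
  rw [Real.sin_three_mul, tr_eq, ← mul_right_inj' (two_ne_zero (α := ℝ))]
  have := Real.sin_sq_add_cos_sq (Real.pi / n)
  linear_combination (-8 * Real.sin (Real.pi / n)) * this

theorem rotNum_penultimate {j : ℕ} (x : ℝ) : rotNum (j + 3) j x =
    Real.sin (Real.pi / (j + 3 : ℕ)) * ((tr (j + 3) - 1) * x + (tr (j + 3) ^ 2 - 2 * tr (j + 3))) := by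
  have h1 := sin_reflect (n := j + 3) (a := j) (b := 3) (by omega) rfl
  have h2 := sin_reflect (n := j + 3) (a := j + 1) (b := 2) (by omega) rfl
  have h3 := sin_two_mul_div (j + 3)
  have h4 := sin_three_mul_div (j + 3)
  push_cast at *
  rw [rotNum]
  push_cast
  rw [h1, h2, h3, h4]
  ring

theorem rotNum_last {j : ℕ} (x : ℝ) : rotNum (j + 3) (j + 1) x =
    Real.sin (Real.pi / (j + 3 : ℕ)) * (x + tr (j + 3) - 1) := by
  have h1 := sin_reflect (n := j + 3) (a := j + 2) (b := 1) (by omega) rfl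
  have h2 := sin_reflect (n := j + 3) (a := j + 1) (b := 2) (by omega) rfl
  have h3 := sin_two_mul_div (j + 3)
  push_cast at *
  rw [one_mul] at h1
  rw [rotNum]
  push_cast
  rw [show (j : ℝ) + 1 + 1 = j + 2 by ring, h1, h2, h3]
  ring

theorem rotNum_full {j : ℕ} (x : ℝ) : rotNum (j + 3) (j + 2) x =
    Real.sin (Real.pi / (j + 3 : ℕ)) := by
  have h1 := sin_reflect (n := j + 3) (a := j + 3) (b := 0) (by omega) rfl
  have h2 := sin_reflect (n := j + 3) (a := j + 2) (b := 1) (by omega) rfl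
  push_cast at *
  rw [one_mul] at h2
  rw [rotNum]
  push_cast
  rw [show (j : ℝ) + 2 + 1 = j + 3 by ring, h1, h2]
  simp

theorem path_short {n : ℕ} (hn : 3 ≤ n) {r x y : ℝ} {d : ℤ} (hr : 0 < r) (hd : d ≠ 0)
    (hx : r - tr n ≤ x) (h : (tr n - 1) * x + (tr n ^ 2 - 2 * tr n) < 0)
    (hy : y = -(x + tr n - 1) / ((tr n - 1) * x + (tr n ^ 2 - 2 * tr n)) + (d + 1) * tr n)
    (h1 : r - tr n ≤ y) (h2 : y < r) :
    Path (tr n) r x (List.replicate (n - 3) (-1) ++ [d]) y := by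
  obtain ⟨j, rfl⟩ := Nat.exists_eq_add_of_le' hn
  have hs : 0 < Real.sin (Real.pi / (j + 3 : ℕ)) := by
    simpa using sin_mul_pos (n := j + 3) (m := 1) le_rfl (by omega)
  rw [Nat.add_sub_cancel]
  refine path_replicate_append hn (by omega) hr hd hx ?_ ?_ h1 h2
  · rw [rotNum_penultimate]
    exact mul_neg_of_pos_of_neg hs h
  · rw [rotNum_penultimate, rotNum_last, ← mul_neg, mul_div_mul_left _ _ hs.ne', hy]

theorem path_long {n : ℕ} (hn : 3 ≤ n) {r x y : ℝ} (hr : 0 < r)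
    (hx : r - tr n ≤ x) (h : x + tr n - 1 < 0) (hy : y = -1 / (x + tr n - 1) - tr n)
    (h1 : r - tr n ≤ y) (h2 : y < r) :
    Path (tr n) r x (List.replicate (n - 2) (-1) ++ [-2]) y := by
  obtain ⟨j, rfl⟩ := Nat.exists_eq_add_of_le' hn
  have hs : 0 < Real.sin (Real.pi / (j + 3 : ℕ)) := by
    simpa using sin_mul_pos (n := j + 3) (m := 1) le_rfl (by omega)
  rw [show j + 3 - 2 = j + 1 by omega]
  refine path_replicate_append hn (by omega) hr (by norm_num) hx ?_ ?_ h1 h2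
  · rw [rotNum_last]
    exact mul_neg_of_pos_of_neg hs h
  · rw [rotNum_full, rotNum_last, neg_div, div_mul_cancel_left₀ hs.ne', hy]
    push_cast
    ring

/-! ### The orbit of the left endpoint -/

/-- The map `y ↦ A⁻¹ C⁻¹ • y`. -/
noncomputable def toLeft (t y : ℝ) : ℝ := 1 / (1 - y) - t

section

variable {n : ℕ} {r : ℝ}

/-- The bound `1 - 1 / r ≤ z` says exactly that `1 / (1 - z) ≥ r`; the upper bound has room to spare
because `r ≤ 1 / 2` and `t ≥ 2`. -/
theorem toLeft_mem {t z : ℝ} (ht : 2 ≤ t) (hr0 : 0 < r) (hr1 : r ≤ 1 / 2) (h1 : 1 - 1 / r ≤ z)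
    (h2 : z ≤ r) : r - t ≤ toLeft t z ∧ toLeft t z < r := by
  have h3 : 0 < 1 - z := by linarith
  constructor
  · rw [toLeft]
    have : r ≤ 1 / (1 - z) := by
      rw [le_div_iff₀ h3]
      have : r * (1 - z) ≤ r * (1 / r) := by gcongr; linarith
      rwa [mul_one_div_cancel hr0.ne'] at this
    linarith
  · rw [toLeft, sub_lt_iff_lt_add, div_lt_iff₀ h3]
    nlinarith

theorem path_start (hn : 3 ≤ n) (hr0 : 0 < r) (hr1 : r ≤ 1 / 2) :
    Path (tr n) r (r - tr n) (List.replicate (n - 2) (-1) ++ [-2]) (toLeft (tr n) r) := by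
  have ht := two_le_tr hn
  have hm := toLeft_mem ht hr0 hr1 (z := r) (by
    have : 1 / (1 / 2) ≤ 1 / r := by gcongr
    norm_num at this ⊢
    linarith) le_rfl
  refine path_long hn hr0 le_rfl (by linarith) ?_ hm.1 hm.2
  rw [toLeft, show r - tr n + tr n - 1 = -(1 - r) by ring, neg_div_neg_eq]

/-- In the coordinate `z`, the word `w` is translation by `t`; the intermediate point after its
first `-2` is `1 - 1 / z - t`. -/
theorem path_wordW (hn : 3 ≤ n) (hr0 : 0 < r) (hr1 : r ≤ 1 / 2) {z : ℝ} (h1 : 1 - 1 / r ≤ z)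
    (h2 : z + tr n ≤ r) :
    Path (tr n) r (toLeft (tr n) z) (wordW n) (toLeft (tr n) (z + tr n)) := by
  have ht := two_le_tr hn
  have hz1 : z < 1 - tr n := by linarith
  have hz0 : z < 0 := by linarith
  have hm := toLeft_mem ht hr0 hr1 h1 (by linarith)
  have hm' := toLeft_mem ht hr0 hr1 (z := z + tr n) (by linarith) h2
  have hz3 : 0 < 1 - z := by linarith
  have hz4 : 0 < -1 / z := div_pos_of_neg_of_neg (by norm_num) hz0
  have hz5 : -1 / z < 1 := by
    rw [div_lt_iff_of_neg hz0]; linarith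
  rw [wordW, List.append_assoc]
  refine (path_long hn hr0 hm.1 (y := 1 - 1 / z - tr n) ?_ ?_ ?_ ?_).append
    (path_short hn hr0 (by norm_num) ?_ ?_ ?_ hm'.1 hm'.2)
  · rw [toLeft]
    have : 1 / (1 - z) < 1 := by rw [div_lt_one hz3]; linarith
    linarith
  · have : toLeft (tr n) z + tr n - 1 = z / (1 - z) := by
      rw [toLeft]; field_simp; ring
    rw [this]
    have := hz0.ne
    field_simp
    ring
  · have : 1 - 1 / z = 1 + -1 / z := by ring
    linarith
  · have : 1 - 1 / z = 1 + -1 / z := by ring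
    linarith
  · have : 1 - 1 / z = 1 + -1 / z := by ring
    linarith
  · have e : (tr n - 1) * (1 - 1 / z - tr n) + (tr n ^ 2 - 2 * tr n) =
        (z + (tr n - 1)) / (-z) := by
      have := hz0.ne
      field_simp
      ring
    rw [e]
    exact div_neg_of_neg_of_pos (by linarith) (by linarith)
  · have e : (tr n - 1) * (1 - 1 / z - tr n) + (tr n ^ 2 - 2 * tr n) =
        (1 - (z + tr n)) / z := by
      have := hz0.ne
      field_simp
      ring
    have h3 : 1 - (z + tr n) ≠ 0 := by linarith
    have := hz0.ne
    rw [e, toLeft]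
    push_cast
    field_simp
    ring

/-- In the coordinate `y`, the block is `A^{i+1} C`: its opening gives `A C`, and each `w` one
further `A`. The bound `r / (1 + t r) ≤ y` is equivalent to `1 - 1 / y + t ≥ 1 - 1 / r`, which is
what `toLeft_mem` asks of the intermediate points; their upper bound follows from that of the last
one. -/
theorem path_block (hn : 3 ≤ n) (hr0 : 0 < r) (hr1 : r ≤ 1 / 2) (hrt : r * tr n < 1) {y : ℝ}
    (h1 : r / (1 + tr n * r) ≤ y) (h2 : y ≤ r) (i : ℕ) (h3 : 1 - 1 / y + (i + 1) * tr n ≤ r) :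
    Path (tr n) r (toLeft (tr n) y)
      (List.replicate (n - 3) (-1) ++ [-2] ++ listPow (wordW n) i)
      (toLeft (tr n) (1 - 1 / y + (i + 1) * tr n)) := by
  have ht := two_le_tr hn
  have hden : 0 < 1 + tr n * r := by positivity
  have hy0 : 0 < y := lt_of_lt_of_le (by positivity) h1
  have hy1 : 1 / y ≤ 1 / r + tr n := by
    have : 1 / y ≤ 1 / (r / (1 + tr n * r)) := one_div_le_one_div_of_le (by positivity) h1
    rw [one_div_div] at this
    have e : (1 + tr n * r) / r = 1 / r + tr n := by field_simp
    linarith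
  induction i with
  | zero =>
    rw [Nat.cast_zero, zero_add, one_mul] at h3 ⊢
    have hm := toLeft_mem (z := y) ht hr0 hr1 (by
      have : 1 < 1 / r := by rw [lt_div_iff₀ hr0]; linarith
      linarith) h2
    have hm' := toLeft_mem (z := 1 - 1 / y + tr n) ht hr0 hr1 (by linarith) h3
    have hty : 0 < 1 - tr n * y := by nlinarith
    have hy3 : 0 < 1 - y := by linarith
    have e : (tr n - 1) * toLeft (tr n) y + (tr n ^ 2 - 2 * tr n) =
        -((1 - tr n * y) / (1 - y)) := by
      rw [toLeft]
      field_simp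
      ring
    rw [listPow_zero, List.append_nil]
    refine path_short hn hr0 (by norm_num) hm.1 ?_ ?_ hm'.1 hm'.2
    · rw [e, neg_lt_zero]
      positivity
    · have e2 : toLeft (tr n) y + tr n - 1 = y / (1 - y) := by
        rw [toLeft]; field_simp; ring
      have e3 : 1 - (1 - 1 / y + tr n) = (1 - tr n * y) / y := by
        field_simp; ring
      rw [e, e2, neg_div_neg_eq, toLeft, e3]
      push_cast
      field_simp
      ring
  | succ i ih =>
    push_cast at h3 ⊢
    have hi : (0 : ℝ) ≤ i * tr n := by positivity
    have hp := path_wordW hn hr0 hr1 (z := 1 - 1 / y + (i + 1) * tr n) (by linarith) (by linarith)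
    rw [show 1 - 1 / y + (i + 1) * tr n + tr n = 1 - 1 / y + (i + 1 + 1) * tr n by ring] at hp
    rw [listPow_succ', ← List.append_assoc]
    exact (ih (by linarith)).append hp

/-- The closing run is the opening of a block with last digit `-1` in place of `-2`. The hypothesis
`h2` is equivalent to the endpoint being below `r`. -/
theorem path_final (hn : 3 ≤ n) (hr0 : 0 < r) (hr1 : r ≤ 1 / 2) (hrt : r * tr n < 1)
    (hr2 : 1 + tr n - r ≤ 1 / r) {x : ℝ} (h1 : r - tr n ≤ x) (h2 : x < r / (1 + tr n * r)) :
    Path (tr n) r (toLeft (tr n) x) (List.replicate (n - 2) (-1)) (x / (1 - tr n * x)) := by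
  have ht := two_le_tr hn
  have hden : 0 < 1 + tr n * r := by positivity
  have hxr : x < r := h2.trans_le (div_le_self hr0.le (by nlinarith))
  have hm := toLeft_mem (z := x) ht hr0 hr1 (by linarith) hxr.le
  have htx : 0 < 1 - tr n * x := by nlinarith
  have hx3 : 0 < 1 - x := by linarith
  have e : (tr n - 1) * toLeft (tr n) x + (tr n ^ 2 - 2 * tr n) =
      -((1 - tr n * x) / (1 - x)) := by
    rw [toLeft]
    field_simp
    ring
  rw [show n - 2 = n - 3 + 1 by omega, List.replicate_succ']
  refine path_short hn hr0 (by norm_num) hm.1 ?_ ?_ ?_ ?_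
  · rw [e, neg_lt_zero]
    positivity
  · have e2 : toLeft (tr n) x + tr n - 1 = x / (1 - x) := by
      rw [toLeft]; field_simp; ring
    rw [e, e2, neg_div_neg_eq]
    push_cast
    field_simp
    ring
  · have : x ≤ x / (1 - tr n * x) := by
      rw [le_div_iff₀ htx]
      nlinarith [mul_nonneg (by linarith : 0 ≤ tr n) (sq_nonneg x)]
    linarith
  · rw [div_lt_iff₀ htx]
    rw [lt_div_iff₀ hden] at h2
    linarith

end

/-! ### Words in two letters and the data attached to a word -/

/-- The product, in reverse order, of the matrices `A ^ a C` along the digits `a` of a word. -/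
noncomputable def letterMatrix (n k : ℕ) : List Bool → GL (Fin 2) ℝ
  | [] => 1
  | b :: l => letterMatrix n k l * (matA n ^ digit k b * matC)

theorem letterMatrix_append (n k : ℕ) (a b : List Bool) :
    letterMatrix n k (a ++ b) = letterMatrix n k b * letterMatrix n k a := by
  induction a with
  | nil => simp [letterMatrix]
  | cons c a ih => simp [letterMatrix, ih, mul_assoc]

theorem letterMatrix_replicate (n k c : ℕ) (b : Bool) :
    letterMatrix n k (List.replicate c b) = (matA n ^ digit k b * matC) ^ c := by
  induction c with
  | zero => rfl
  | succ c ih => rw [List.replicate_succ, letterMatrix, ih, pow_succ]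

theorem rightMatrix_eq (n k : ℕ) (v : List ℕ) :
    rightMatrix n k v = letterMatrix n k (letters true v) := by
  induction v using rightMatrix.induct with
  | case1 => rfl
  | case2 c => simp [rightMatrix, letters, letterMatrix_replicate, digit]
  | case3 c d v ih =>
    simp [rightMatrix, letters, letterMatrix_append, letterMatrix_replicate, digit, ih, mul_assoc]

theorem upperDigits_eq (k : ℕ) (v : List ℕ) :
    upperDigits k v = (letters true v).map fun b => (digit k b : ℤ) := by
  induction v using upperDigits.induct with
  | case1 => rfl
  | case2 c => simp [upperDigits, letters, digit]
  | case3 c d v ih => simp [upperDigits, letters, digit, ih]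

/-- The block of lower digits attached to a letter. -/
def letterBlock (n k : ℕ) (b : Bool) : List ℤ :=
  List.replicate (n - 3) (-1) ++ [-2] ++ listPow (wordW n) (digit k b - 1)

theorem flatMap_replicate_eq {X Y : Type*} (f : X → List Y) (c : ℕ) (b : X) :
    (List.replicate c b).flatMap f = listPow (f b) c := by
  simp [listPow, List.flatMap]

theorem blockDigits_eq (n k : ℕ) (v : List ℕ) :
    blockDigits n k v = (letters true v).flatMap (letterBlock n k) := by
  have hC : letterBlock n k true = blockC n k := rfl
  have hD : letterBlock n k false = blockD n k := by simp [letterBlock, blockD, digit]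
  induction v using blockDigits.induct with
  | case1 => rfl
  | case2 c => simp [blockDigits, letters, flatMap_replicate_eq, hC]
  | case3 c d v ih =>
    simp [blockDigits, letters, List.flatMap_append, flatMap_replicate_eq, hC, hD, ih]

/-! ### Matrix identities -/

theorem matC_pow_three : matC ^ 3 = 1 := by
  ext i j
  fin_cases i <;> fin_cases j <;>
    simp [matC, mu_eq, Matrix.GeneralLinearGroup.mkOfDetNeZero, pow_succ]

theorem rot_val (n : ℕ) :
    (((matA n)⁻¹ * matC : GL (Fin 2) ℝ) : Matrix (Fin 2) (Fin 2) ℝ) =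
      !![tr n - 1, 1; -1, 0] := by
  have e : (matA n)⁻¹ * matC =
      Matrix.GeneralLinearGroup.mkOfDetNeZero !![tr n - 1, 1; -1, 0]
        (by simp [Matrix.det_fin_two]) := by
    rw [inv_mul_eq_iff_eq_mul]
    ext i j
    fin_cases i <;> fin_cases j <;>
      simp [matC, matA, mu_eq, Matrix.GeneralLinearGroup.mkOfDetNeZero, Matrix.mul_apply,
        Fin.sum_univ_two]
    ring
  rw [e]
  rfl

theorem sin_smul_rot_pow (n m : ℕ) :
    Real.sin (Real.pi / n) •
        ((((matA n)⁻¹ * matC) ^ m : GL (Fin 2) ℝ) : Matrix (Fin 2) (Fin 2) ℝ) =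
      !![Real.sin ((m + 1) * (Real.pi / n)), Real.sin (m * (Real.pi / n));
        -Real.sin (m * (Real.pi / n)), -Real.sin ((m - 1) * (Real.pi / n))] := by
  induction m with
  | zero =>
    ext i j
    fin_cases i <;> fin_cases j <;> simp
  | succ m ih =>
    rw [pow_succ, Units.val_mul, ← Matrix.smul_mul, ih, rot_val]
    have h1 := sin_add_two_mul m (Real.pi / n)
    have h2 := sin_add_two_mul (m - 1) (Real.pi / n)
    rw [sub_add_cancel] at h2
    ext i j
    fin_cases i <;> fin_cases j <;> simp [Matrix.mul_apply, Fin.sum_univ_two, tr_eq]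
    · rw [h1]; ring
    · rw [h2]; ring

/-- The matrix has determinant 1 and trace `2 cos (π / n)`, so it is a rotation by `π / n` up to
conjugacy. The sine form of the powers is evaluated at `m = n`. -/
theorem rot_pow_eq_neg_one {n : ℕ} (hn : 3 ≤ n) : ((matA n)⁻¹ * matC) ^ n = -1 := by
  have hs : 0 < Real.sin (Real.pi / n) := by
    simpa using sin_mul_pos (n := n) (m := 1) le_rfl (by omega)
  have h := sin_smul_rot_pow n n
  have hn0 : (n : ℝ) ≠ 0 := by exact_mod_cast (by omega : n ≠ 0)
  have e : (n : ℝ) * (Real.pi / n) = Real.pi := by field_simp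
  rw [add_mul, sub_mul, one_mul, e, add_comm, Real.sin_add_pi, Real.sin_pi, Real.sin_pi_sub] at h
  apply Units.ext
  rw [← (smul_right_injective _ hs.ne').eq_iff]
  rw [h]
  ext i j
  fin_cases i <;> fin_cases j <;> simp

theorem matC_inv_mul_inv : (matC)⁻¹ * (matC)⁻¹ = matC := by
  rw [← mul_inv_rev, inv_eq_iff_mul_eq_one, ← matC_pow_three]
  simp [pow_succ]

theorem matC_mul_self : matC * matC = matC⁻¹ := by
  rw [eq_inv_iff_mul_eq_one, ← matC_pow_three]
  simp [pow_succ]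

theorem rot_pow_sub_one {n : ℕ} (hn : 3 ≤ n) :
    ((matA n)⁻¹ * matC) ^ (n - 1) = -(matC⁻¹ * matA n) := by
  have h := rot_pow_eq_neg_one hn
  rw [show n = n - 1 + 1 by omega, pow_succ, ← eq_mul_inv_iff_mul_eq, Nat.sub_add_cancel (by omega)]
    at h
  rw [h]
  simp

theorem rot_pow_sub_two {n : ℕ} (hn : 3 ≤ n) :
    ((matA n)⁻¹ * matC) ^ (n - 2) = -(matC⁻¹ * matA n * matC⁻¹ * matA n) := by
  have h := rot_pow_sub_one hn
  rw [show n - 1 = n - 2 + 1 by omega, pow_succ, ← eq_mul_inv_iff_mul_eq] at h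
  rw [h]
  simp [mul_assoc]

theorem inv_two_mul_rot_pow {n : ℕ} (m : ℕ) :
    (matA n ^ (-2 : ℤ) * matC) * ((matA n)⁻¹ * matC) ^ m =
      (matA n)⁻¹ * ((matA n)⁻¹ * matC) ^ (m + 1) := by
  rw [pow_succ', zpow_neg]
  simp only [mul_assoc, zpow_ofNat, pow_succ, pow_zero, one_mul, mul_inv_rev]

theorem matW_eq {n : ℕ} (hn : 3 ≤ n) :
    matW n = (matC * matA n)⁻¹ * matA n * (matC * matA n) := by
  have e : matW n = (matA n ^ (-2 : ℤ) * matC) * ((matA n)⁻¹ * matC) ^ (n - 3) *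
      ((matA n ^ (-2 : ℤ) * matC) * ((matA n)⁻¹ * matC) ^ (n - 2)) := by
    simp only [matW, mul_assoc]
  rw [e, inv_two_mul_rot_pow, inv_two_mul_rot_pow, show n - 3 + 1 = n - 2 by omega,
    show n - 2 + 1 = n - 1 by omega, rot_pow_sub_one hn, rot_pow_sub_two hn]
  have h : ∀ z : GL (Fin 2) ℝ, (matC)⁻¹ * ((matC)⁻¹ * z) = matC * z := fun z => by
    rw [← mul_assoc, matC_inv_mul_inv]
  simp [mul_assoc, h]

theorem matW_pow_eq {n : ℕ} (hn : 3 ≤ n) (j : ℕ) :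
    matW n ^ j = (matC * matA n)⁻¹ * matA n ^ j * (matC * matA n) := by
  induction j with
  | zero => simp
  | succ j ih => rw [pow_succ, ih, matW_eq hn, pow_succ]; simp only [mul_assoc, mul_inv_cancel_left]

/-- Matrix counterpart of `path_block`: conjugation by `C A` turns a block into one right-hand
letter, with a sign from `(A⁻¹C)^n = -1`. -/
theorem matW_pow_mul_eq {n : ℕ} (hn : 3 ≤ n) (j : ℕ) :
    matW n ^ j * (matA n ^ (-2 : ℤ) * matC) * ((matA n)⁻¹ * matC) ^ (n - 3) =
      -((matC * matA n)⁻¹ * (matA n ^ (j + 1) * matC) * (matC * matA n)) := by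
  rw [mul_assoc, inv_two_mul_rot_pow, show n - 3 + 1 = n - 2 by omega, rot_pow_sub_two hn,
    matW_pow_eq hn]
  have h : ∀ z : GL (Fin 2) ℝ, matC * (matC * z) = matC⁻¹ * z := fun z => by
    rw [← mul_assoc, matC_mul_self]
  simp [mul_assoc, h, pow_succ]

theorem eq_or_eq_neg_mul {G : Type*} [Group G] [HasDistribNeg G] {a b c d : G}
    (h : a = b ∨ a = -b) (h' : c = d ∨ c = -d) : a * c = b * d ∨ a * c = -(b * d) := by
  rcases h with rfl | rfl <;> rcases h' with rfl | rfl <;> simp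

theorem eq_or_eq_neg_pow {G : Type*} [Group G] [HasDistribNeg G] {a b : G}
    (h : a = b ∨ a = -b) (c : ℕ) : a ^ c = b ^ c ∨ a ^ c = -b ^ c := by
  induction c with
  | zero => simp
  | succ c ih => rw [pow_succ, pow_succ]; exact eq_or_eq_neg_mul ih h

theorem conj_pow' {G : Type*} [Group G] (g a : G) (c : ℕ) : (g⁻¹ * a * g) ^ c = g⁻¹ * a ^ c * g := by
  simpa using conj_pow (i := c) (a := g⁻¹) (b := a)

theorem blockMatrix_eq {n k : ℕ} (hn : 3 ≤ n) (hk : 1 ≤ k) (v : List ℕ) :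
    blockMatrix n k v = (matC * matA n)⁻¹ * rightMatrix n k v * (matC * matA n) ∨
      blockMatrix n k v = -((matC * matA n)⁻¹ * rightMatrix n k v * (matC * matA n)) := by
  set g := matC * matA n with hg
  have hC : ∀ c, matBlockC n k ^ c = g⁻¹ * (matA n ^ k * matC) ^ c * g ∨
      matBlockC n k ^ c = -(g⁻¹ * (matA n ^ k * matC) ^ c * g) := by
    intro c
    rw [← conj_pow']
    apply eq_or_eq_neg_pow
    right
    rw [matBlockC, matW_pow_mul_eq hn, Nat.sub_add_cancel hk]
  have hD : ∀ c, matBlockD n k ^ c = g⁻¹ * (matA n ^ (k + 1) * matC) ^ c * g ∨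
      matBlockD n k ^ c = -(g⁻¹ * (matA n ^ (k + 1) * matC) ^ c * g) := by
    intro c
    rw [← conj_pow']
    apply eq_or_eq_neg_pow
    right
    rw [matBlockD, matW_pow_mul_eq hn]
  induction v using rightMatrix.induct with
  | case1 => left; simp [blockMatrix, rightMatrix]
  | case2 c => exact hC c
  | case3 c d v ih =>
    have h := eq_or_eq_neg_mul (eq_or_eq_neg_mul ih (hD d)) (hC c)
    simpa only [blockMatrix, rightMatrix, mul_assoc, mul_inv_cancel_left] using h

/-- Up to sign, the factors around the conjugated `R_{k,v}` reduce to `C⁻¹AC⁻¹A` on the left and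
`A⁻¹C⁻¹` on the right. The conjugators then cancel, leaving `C⁻¹AC⁻²R_{k,v}`, and `C⁻² = C`. -/
theorem leftMatrix_eq {n k : ℕ} (hn : 3 ≤ n) (hk : 1 ≤ k) (v : List ℕ) :
    leftMatrix n k v = matC⁻¹ * matA n * matC * rightMatrix n k v ∨
      leftMatrix n k v = -(matC⁻¹ * matA n * matC * rightMatrix n k v) := by
  have e : leftMatrix n k v = ((matA n)⁻¹ * matC) ^ (n - 2) * (blockMatrix n k v *
      ((matA n ^ (-2 : ℤ) * matC) * ((matA n)⁻¹ * matC) ^ (n - 2)) * (matA n)⁻¹) := by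
    simp only [leftMatrix, mul_assoc]
  have h : ∀ z : GL (Fin 2) ℝ, (matC)⁻¹ * ((matC)⁻¹ * z) = matC * z := fun z => by
    rw [← mul_assoc, matC_inv_mul_inv]
  rw [e, inv_two_mul_rot_pow, show n - 2 + 1 = n - 1 by omega, rot_pow_sub_one hn,
    rot_pow_sub_two hn]
  rcases blockMatrix_eq hn hk v with h' | h' <;> rw [h'] <;> simp [mul_assoc, h]

/-! ### Digits and orbits along chains of points -/

theorem matA_zpow_smul (n : ℕ) (j : ℤ) (y : ℝ) :
    (matA n ^ j) • (y : OnePoint ℝ) = ((y + j * tr n : ℝ) : OnePoint ℝ) := by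
  obtain ⟨m, rfl | rfl⟩ := j.eq_nat_or_neg
  · simpa using matA_pow_smul n m y
  · rw [zpow_neg, inv_smul_eq_iff, zpow_natCast, matA_pow_smul]
    push_cast
    congr 1
    ring

theorem matC_smul {x : ℝ} (hx : x ≠ 0) :
    matC • (x : OnePoint ℝ) = ((1 - 1 / x : ℝ) : OnePoint ℝ) := by
  rw [OnePoint.smul_some_eq_ite]
  simp only [matC, Matrix.GeneralLinearGroup.mkOfDetNeZero]
  simp only [Matrix.unitOfDetInvertible, Matrix.GeneralLinearGroup.mk'] at *
  simp [hx, mu_eq]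
  field_simp
  ring

theorem coe_mem_interval {n : ℕ} {α y : ℝ} :
    (y : OnePoint ℝ) ∈ interval n α ↔ α * tr n - tr n ≤ y ∧ y < α * tr n := by
  rw [interval, Function.Injective.mem_set_image (OnePoint.coe_injective), Set.mem_Ico, sub_mul,
    one_mul]

theorem isLeast_exitExponents_one {n : ℕ} {α : ℝ} {x : OnePoint ℝ}
    (h : matC • x ∉ interval n α) : IsLeast (exitExponents n α x) 1 :=
  ⟨⟨le_rfl, by simpa using h⟩, fun _ hl => hl.1⟩

theorem cfMap_eq_of_notMem {n : ℕ} {α : ℝ} {x : OnePoint ℝ} {c : ℝ}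
    (hc : matC • x = (c : OnePoint ℝ)) (h : (c : OnePoint ℝ) ∉ interval n α) :
    cfMap n α x = ((c - ⌊c / tr n + 1 - α⌋ * tr n : ℝ) : OnePoint ℝ) := by
  have h1 := (isLeast_exitExponents_one (x := x) (hc ▸ h)).csInf_eq
  rw [cfMap, h1, pow_one, hc, matA_zpow_smul]
  congr 1
  rw [returnExponent, OnePoint.elim_some]
  push_cast
  ring

/-- The interval has length `t` and contains `y`, so a nonzero `d` forces `C • x` outside it. Hence
the exit exponent is 1, and the floor recovers `d`. -/
theorem mem_cylinder_and_cfMap_eq {n : ℕ} (hn : 3 ≤ n) {α x y : ℝ} {d : ℤ} (hx : x ≠ 0)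
    (hd : d ≠ 0) (h1 : α * tr n - tr n ≤ x) (h2 : x ≤ α * tr n) (hy : y = 1 - 1 / x + d * tr n)
    (h3 : α * tr n - tr n ≤ y) (h4 : y < α * tr n) :
    (x : OnePoint ℝ) ∈ cylinder n α d 1 ∧ cfMap n α (x : OnePoint ℝ) = (y : OnePoint ℝ) := by
  have ht := two_le_tr hn
  have ht0 : 0 < tr n := by linarith
  have hc := matC_smul hx
  have hmem : ((1 - 1 / x : ℝ) : OnePoint ℝ) ∉ interval n α := by
    rw [coe_mem_interval]
    rintro ⟨h5, h6⟩
    rcases lt_or_gt_of_ne hd with hd | hd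
    · have : (d : ℝ) ≤ -1 := by exact_mod_cast (by omega : d ≤ -1)
      nlinarith
    · have : (1 : ℝ) ≤ d := by exact_mod_cast (by omega : 1 ≤ d)
      nlinarith
  have hfl : ⌊(1 - 1 / x) / tr n + 1 - α⌋ = -d := by
    rw [Int.floor_eq_iff]
    have e : (1 - 1 / x) / tr n + 1 - α = (y - (α * tr n - tr n)) / tr n - d := by
      rw [hy]; field_simp; ring
    have h5 : 0 ≤ (y - (α * tr n - tr n)) / tr n := div_nonneg (by linarith) ht0.le
    have h6 : (y - (α * tr n - tr n)) / tr n < 1 := by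
      rw [div_lt_one ht0]; linarith
    rw [e]
    push_cast
    constructor <;> linarith
  refine ⟨⟨⟨x, ⟨by linarith, h2⟩, rfl⟩, isLeast_exitExponents_one (hc ▸ hmem), ?_, ?_⟩, ?_⟩
  · rw [pow_one, hc]; exact OnePoint.coe_ne_infty _
  · rw [pow_one, hc, returnExponent, OnePoint.elim_some, hfl, neg_neg]
  · rw [cfMap_eq_of_notMem hc hmem, hfl, hy]
    push_cast
    congr 1
    ring

theorem Path.digits {n : ℕ} (hn : 3 ≤ n) {α x z : ℝ} {ds : List ℤ}
    (h : Path (tr n) (α * tr n) x ds z) :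
    HasInitialSimplifiedDigits n α (x : OnePoint ℝ) ds ∧
      (cfMap n α)^[ds.length] (x : OnePoint ℝ) = (z : OnePoint ℝ) := by
  induction h with
  | nil x => exact ⟨fun i hi => absurd hi (by simp), rfl⟩
  | cons hx hd h1 h2 hy h3 h4 _ ih =>
    obtain ⟨h5, h6⟩ := mem_cylinder_and_cfMap_eq hn hx hd h1 h2 hy h3 h4
    refine ⟨fun i hi => ?_, ?_⟩
    · rcases i with _ | i
      · exact h5
      · have := ih.1 i (by simpa using hi)
        rw [Function.iterate_succ_apply, h6]
        simpa using this
    · rw [List.length_cons, Function.iterate_succ_apply, h6]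
      exact ih.2

/-! ### Parameters in a potential synchronization interval -/

theorem letterMatrix_inv_smul {n k : ℕ} (hn : 3 ≤ n) (hk : 1 ≤ k) (l : List Bool) {y : ℝ}
    (h1 : -tr n ≤ y) (h2 : y ≤ 1 / 2) :
    (letterMatrix n k l)⁻¹ • (y : OnePoint ℝ) = ((branch (tr n) k l y : ℝ) : OnePoint ℝ) := by
  have ht := two_le_tr hn
  induction l with
  | nil => simp [letterMatrix, branch]
  | cons b l ih =>
    have h3 := (branch_mem ht hk l h1 h2).2.1
    have h4 := two_le_digit_mul ht hk b
    have h5 : digit k b * tr n + 1 - branch (tr n) k l y ≠ 0 := by linarith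
    rw [letterMatrix, mul_inv_rev, mul_smul, ih, inv_smul_eq_iff, mul_smul, branch,
      matC_smul (one_div_ne_zero h5), matA_pow_smul, one_div_one_div]
    congr 1
    ring

theorem parabolic_smul {n : ℕ} {x : ℝ} (hx : 1 - tr n * x ≠ 0) :
    (matC⁻¹ * matA n * matC) • (x : OnePoint ℝ) = ((x / (1 - tr n * x) : ℝ) : OnePoint ℝ) := by
  have e : matC⁻¹ * matA n * matC = Matrix.GeneralLinearGroup.mkOfDetNeZero !![1, 0; -tr n, 1]
      (by simp [Matrix.det_fin_two]) := by
    rw [mul_assoc, inv_mul_eq_iff_eq_mul]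
    ext i j
    fin_cases i <;> fin_cases j <;>
      simp [matC, matA, mu_eq, Matrix.GeneralLinearGroup.mkOfDetNeZero, Matrix.mul_apply,
        Fin.sum_univ_two]
  have h2 : -tr n * x + 1 ≠ 0 := by rwa [neg_mul, neg_add_eq_sub]
  rw [e, OnePoint.smul_some_eq_ite]
  simp only [Matrix.GeneralLinearGroup.mkOfDetNeZero]
  have : x / (-tr n * x + 1) = x / (1 - tr n * x) := by rw [neg_mul, neg_add_eq_sub]
  simpa [h2, ← neg_mul] using this

theorem div_one_add_mem {t x : ℝ} (ht : 2 ≤ t) (hx : 0 ≤ x) :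
    -t ≤ x / (1 + t * x) ∧ x / (1 + t * x) ≤ 1 / 2 := by
  have h1 : 0 < 1 + t * x := by positivity
  have h2 : 0 ≤ x / (1 + t * x) := by positivity
  refine ⟨by linarith, ?_⟩
  rw [div_le_div_iff₀ h1 (by norm_num)]
  nlinarith

/-- The equations for `ζ` and `η` are fixed-point equations for the increasing maps `r ↦ g (r - t)`
and `r ↦ g (r / (1 + t r))`. As neither expands distances, `g (r - t) ≤ r` from `ζ t` on, and `r < g
(r / (1 + t r))` before `η t`; the intermediate value theorem supplies `x`. Equality is possible
only at the left end, matching the half-open `𝒥_{k,v}`. -/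
theorem exists_branch_eq {n k : ℕ} (hn : 3 ≤ n) (hk : 1 ≤ k) {v : List ℕ} {l : List Bool}
    (hl : letters true v = true :: l) {α : ℝ} (hα : α ∈ syncInterval n k v) :
    0 < α * tr n ∧ α * tr n ≤ 1 / 2 ∧ ∃ x, α * tr n - tr n ≤ x ∧
      x < α * tr n / (1 + tr n * (α * tr n)) ∧
      branch (tr n) k (letters true v) x = α * tr n := by
  obtain ⟨ζ, η, ⟨⟨hζ0, hζ1⟩, hζ⟩, ⟨⟨hη0, hη1⟩, hη⟩, hα1, hα2⟩ := hα
  have ht := two_le_tr hn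
  have ht0 : 0 < tr n := by linarith
  set g := branch (tr n) k (letters true v) with hg
  have hmem : ∀ {x}, -tr n ≤ x → x ≤ 1 / 2 → 0 < g x ∧ g x ≤ 1 / 2 := fun h1 h2 => by
    have := branch_mem ht hk (letters true v) h1 h2
    exact ⟨this.2.2 (by simp [hl]), this.2.1⟩
  have hmono : ∀ {x y}, -tr n ≤ x → x < y → y ≤ 1 / 2 → g x < g y ∧ g y - g x ≤ y - x :=
    fun h1 h2 h3 => branch_mono ht hk (letters true v) h1 h2 h3
  have hz : g (ζ * tr n - tr n) = ζ * tr n := by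
    have h1 : -tr n ≤ ζ * tr n - tr n := by nlinarith
    have h2 : ζ * tr n - tr n ≤ 1 / 2 := by nlinarith
    rw [rightEnd, leftEnd, sub_mul, one_mul, rightMatrix_eq, ← eq_inv_smul_iff,
      letterMatrix_inv_smul hn hk _ h1 h2, OnePoint.coe_eq_coe] at hζ
    exact hζ.symm
  have he : g (η * tr n / (1 + tr n * (η * tr n))) = η * tr n := by
    have h0 : 0 ≤ η * tr n := by positivity
    have h1 := div_one_add_mem ht h0
    have h2 : 0 < 1 + tr n * (η * tr n) := by positivity
    have h3 : 1 - tr n * (η * tr n / (1 + tr n * (η * tr n))) = 1 / (1 + tr n * (η * tr n)) := by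
      field_simp
      ring
    have h4 : (matC⁻¹ * matA n * matC) • ((η * tr n / (1 + tr n * (η * tr n)) : ℝ) : OnePoint ℝ) =
        ((η * tr n : ℝ) : OnePoint ℝ) := by
      rw [parabolic_smul (by rw [h3]; positivity), h3]
      congr 1
      field_simp
    rw [rightEnd, mul_smul (matC⁻¹ * matA n * matC)] at hη
    nth_rewrite 1 [← h4] at hη
    rw [smul_left_cancel_iff, ← inv_smul_eq_iff, rightMatrix_eq,
      letterMatrix_inv_smul hn hk _ h1.1 h1.2, OnePoint.coe_eq_coe] at hη
    exact hη
  have hz0 : 0 < ζ * tr n := by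
    have h1 : -tr n ≤ ζ * tr n - tr n := by nlinarith
    have h2 : ζ * tr n - tr n ≤ 1 / 2 := by nlinarith
    rw [← hz]
    exact (hmem h1 h2).1
  have he1 : η * tr n ≤ 1 / 2 := by
    rw [← he]
    have h1 := div_one_add_mem ht (x := η * tr n) (by positivity)
    exact (hmem h1.1 h1.2).2
  have hzr : ζ * tr n ≤ α * tr n := by gcongr
  have hre : α * tr n < η * tr n := by gcongr
  set r := α * tr n with hr
  set s := fun x : ℝ => x / (1 + tr n * x) with hs
  have hr0 : 0 < r := by linarith
  have hs0 : 0 < s r := by simp only [hs]; positivity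
  have hlow : g (r - tr n) ≤ r := by
    rcases hzr.eq_or_lt with h | h
    · rw [← h, hz]
    · have := (hmono (x := ζ * tr n - tr n) (y := r - tr n) (by linarith) (by linarith)
        (by linarith)).2
      linarith
  have hhigh : r < g (s r) := by
    have hd : s (η * tr n) - s r = (η * tr n - r) / ((1 + tr n * (η * tr n)) * (1 + tr n * r)) := by
      have h1 : 0 < 1 + tr n * r := by positivity
      have h2 : 0 < 1 + tr n * (η * tr n) := by positivity
      simp only [hs]
      field_simp
      ring
    have hp : 1 < (1 + tr n * (η * tr n)) * (1 + tr n * r) := by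
      have h1 : 0 < tr n * r := by positivity
      have h2 : 0 < tr n * (η * tr n) := mul_pos ht0 (by linarith)
      nlinarith [mul_pos h1 h2]
    have hd1 : 0 < s (η * tr n) - s r := by
      rw [hd]; exact div_pos (by linarith) (by linarith)
    have hd2 : s (η * tr n) - s r < η * tr n - r := by
      rw [hd]; exact div_lt_self (by linarith) hp
    have h3 := (hmono (x := s r) (y := s (η * tr n)) (by linarith) (by linarith)
      (div_one_add_mem ht (by linarith)).2).2
    have h4 : g (s (η * tr n)) = η * tr n := he
    linarith
  have hsr : s r ≤ 1 / 2 := (div_one_add_mem ht hr0.le).2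
  have hcont : ContinuousOn g (Set.Icc (r - tr n) (s r)) := by
    have hlip : LipschitzOnWith 1 g (Set.Icc (r - tr n) (s r)) := by
      apply LipschitzOnWith.of_le_add_mul
      intro x hx y hy
      rw [NNReal.coe_one, one_mul, Real.dist_eq]
      rcases lt_trichotomy x y with h | h | h
      · have := (hmono (by linarith [hx.1]) h (by linarith [hy.2])).1
        linarith [abs_nonneg (x - y)]
      · simp [h]
      · have := (hmono (by linarith [hy.1]) h (by linarith [hx.2])).2
        linarith [le_abs_self (x - y)]
    exact hlip.continuousOn
  obtain ⟨x, hx, hxr⟩ := intermediate_value_Icc (by linarith : r - tr n ≤ s r) hcont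
    (show r ∈ Set.Icc _ _ from ⟨hlow, hhigh.le⟩)
  refine ⟨hr0, by linarith, x, hx.1, lt_of_le_of_ne hx.2 fun e => ?_, hxr⟩
  rw [e] at hxr
  have : g (s r) = r := hxr
  linarith

/-! ### Synchronization -/

section

variable {n k : ℕ} {v z : List Bool} {x r : ℝ}

/-- Removing a first letter gives the next orbit point, from a proper suffix or equal to `x`; hence
strictly below `r`. -/
theorem Extremal.lt_right (h : Extremal v z) (ht : 2 ≤ tr n) (hk : 1 ≤ k) (hr0 : 0 < r)
    (hr1 : r ≤ 1 / 2) (h1 : r - tr n ≤ x) (h2 : x < r / (1 + tr n * r))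
    (hr : branch (tr n) k v x = r) {b : Bool} {l : List Bool} (hy : b :: l <:+ v) :
    r - tr n ≤ branch (tr n) k l x ∧ branch (tr n) k l x < r := by
  rcases l with _ | ⟨c, l⟩
  · exact ⟨h1, h2.trans_le (div_le_self hr0.le (by nlinarith))⟩
  · have hs : c :: l <:+ v := (List.suffix_cons _ _).trans hy
    have hb := h.branch_bounds ht hk hr0 hr1 h1 h2 hr hs (by simp)
    refine ⟨?_, hb.2.2 fun e => ?_⟩
    · have : 0 < r / (1 + tr n * r) := by positivity
      linarith
    · have := hy.length_le
      rw [← e] at this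
      simp at this

theorem Extremal.path_upper (h : Extremal v z) (ht : 2 ≤ tr n) (hk : 1 ≤ k) (hr0 : 0 < r)
    (hr1 : r ≤ 1 / 2) (h1 : r - tr n ≤ x) (h2 : x < r / (1 + tr n * r))
    (hr : branch (tr n) k v x = r) {y : List Bool} (hy : y <:+ v) :
    Path (tr n) r (branch (tr n) k y x) (y.map fun b => (digit k b : ℤ)) x := by
  induction y with
  | nil => exact .nil x
  | cons b l ih =>
    have hb := h.branch_bounds ht hk hr0 hr1 h1 h2 hr hy (by simp)
    have hp : 0 < r / (1 + tr n * r) := by positivity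
    have hl := h.lt_right ht hk hr0 hr1 h1 h2 hr hy
    refine .cons (by linarith) ?_ (by linarith) hb.2.1 ?_ hl.1 hl.2
      (ih ((List.suffix_cons _ _).trans hy))
    · rcases b <;> simp [digit] <;> omega
    · rw [branch, one_div_one_div]
      push_cast
      ring

theorem Extremal.path_blocks (h : Extremal v z) (hn : 3 ≤ n) (hk : 1 ≤ k) (hr0 : 0 < r)
    (hr1 : r ≤ 1 / 2) (hrt : r * tr n < 1) (h1 : r - tr n ≤ x) (h2 : x < r / (1 + tr n * r))
    (hr : branch (tr n) k v x = r) {y : List Bool} (hy : y <:+ v) :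
    Path (tr n) r (toLeft (tr n) (branch (tr n) k y x)) (y.flatMap (letterBlock n k))
      (toLeft (tr n) x) := by
  have ht := two_le_tr hn
  induction y with
  | nil => exact .nil _
  | cons b l ih =>
    have hb := h.branch_bounds ht hk hr0 hr1 h1 h2 hr hy (by simp)
    have hl := h.lt_right ht hk hr0 hr1 h1 h2 hr hy
    have hd : 1 ≤ digit k b := by rcases b <;> simp [digit] <;> omega
    have e : branch (tr n) k l x =
        1 - 1 / branch (tr n) k (b :: l) x + ((digit k b - 1 : ℕ) + 1) * tr n := by
      rw [branch, one_div_one_div, Nat.cast_sub hd]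
      push_cast
      ring
    rw [List.flatMap_cons]
    have hp := path_block hn hr0 hr1 hrt hb.1 hb.2.1 (digit k b - 1) (by rw [← e]; exact hl.2.le)
    rw [← e] at hp
    exact hp.append (ih ((List.suffix_cons _ _).trans hy))

end

/-- Applying `C` to the two points gives `A C • x` and `C • x`, which have the same representative
modulo `t`. For `x < 0` both lie above 1, and for `x > 0` both lie below `r - t`, so neither needs a
second `C`. At `x = 0` the two points coincide. -/
theorem cfMap_eq_cfMap_parabolic {n : ℕ} (hn : 3 ≤ n) {α x : ℝ} (hr0 : 0 < α * tr n)
    (hr1 : α * tr n ≤ 1 / 2) (hr2 : 1 + tr n - α * tr n ≤ 1 / (α * tr n))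
    (h2 : x < α * tr n / (1 + tr n * (α * tr n))) :
    cfMap n α ((x / (1 - tr n * x) : ℝ) : OnePoint ℝ) = cfMap n α (x : OnePoint ℝ) := by
  have ht := two_le_tr hn
  have ht0 : 0 < tr n := by linarith
  rcases eq_or_ne x 0 with rfl | hx
  · simp
  set r := α * tr n with hr
  have htx : 0 < 1 - tr n * x := by
    have h3 : x * (1 + tr n * r) < r := by rwa [lt_div_iff₀ (by positivity)] at h2
    rcases le_or_gt x 0 with h | h
    · nlinarith
    · by_contra hneg
      have h4 : r * 1 ≤ r * (tr n * x) := by gcongr; linarith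
      nlinarith
  have hy : x / (1 - tr n * x) ≠ 0 := div_ne_zero hx htx.ne'
  have e : 1 - 1 / (x / (1 - tr n * x)) = 1 - 1 / x + tr n := by
    rw [one_div_div]
    field_simp
    ring
  have hcx := matC_smul hx
  have hcy := matC_smul hy
  rw [e] at hcy
  have hout : (1 < 1 - 1 / x) ∨ 1 - 1 / x + tr n < r - tr n := by
    rcases lt_or_gt_of_ne hx with h | h
    · left
      have := one_div_neg.2 h
      linarith
    · right
      have h3 : 1 / (r / (1 + tr n * r)) < 1 / x := one_div_lt_one_div_of_lt h h2
      rw [one_div_div] at h3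
      have e' : (1 + tr n * r) / r = 1 / r + tr n := by field_simp
      linarith
  rw [cfMap_eq_of_notMem hcx, cfMap_eq_of_notMem hcy]
  · rw [show (1 - 1 / x + tr n) / tr n + 1 - α = (1 - 1 / x) / tr n + 1 - α + 1 by
      field_simp; ring, Int.floor_add_one]
    push_cast
    congr 1
    ring
  · rw [coe_mem_interval]
    rintro ⟨h5, h6⟩
    rcases hout with h | h <;> linarith
  · rw [coe_mem_interval]
    rintro ⟨h5, h6⟩
    rcases hout with h | h <;> linarith

theorem synchronization {n k : ℕ} (hn : 3 ≤ n) (hk : 1 ≤ k) {v : List ℕ} (hv : v ∈ words) {α : ℝ}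
    (hα : α ∈ syncInterval n k v) :
    HasInitialSimplifiedDigits n α (leftEnd n α) (lowerDigits n k v) ∧
      leftOrbit n α (lowerDigits n k v).length =
        (matC⁻¹ * matA n * matC) • rightOrbit n α (upperDigits k v).length ∧
      leftOrbit n α ((lowerDigits n k v).length + 1) =
        rightOrbit n α ((upperDigits k v).length + 1) := by
  have ht := two_le_tr hn
  obtain ⟨z, hz⟩ := exists_wordState hv
  have hE := hz.extremal
  obtain ⟨l, hl⟩ := hE.head
  obtain ⟨hr0, hr1, x, h1, h2, hx⟩ := exists_branch_eq hn hk hl hα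
  have hb := (hE.lt_right ht hk hr0 hr1 h1 h2 hx (b := true) (l := l) (by rw [hl])).2
  -- The first letter of `v` is `true`, with digit `k ≥ 1`, and the next point of the right orbit is
  -- below `r`.
  have hr2 : 1 + tr n - α * tr n ≤ 1 / (α * tr n) := by
    have e : 1 / (α * tr n) = k * tr n + 1 - branch (tr n) k l x := by
      rw [← hx, hl, branch, one_div_one_div]
      rfl
    have hk' : (1 : ℝ) ≤ k := by exact_mod_cast hk
    nlinarith
  have hrt : α * tr n * tr n < 1 := by
    have h3 : tr n < 1 / (α * tr n) := by linarith
    rwa [lt_div_iff₀ hr0, mul_comm] at h3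
  have hden : 1 - tr n * x ≠ 0 := by
    have h3 : x < α * tr n := h2.trans_le (div_le_self hr0.le (by nlinarith))
    nlinarith
  have hup := hE.path_upper ht hk hr0 hr1 h1 h2 hx List.suffix_rfl
  have hmid := hE.path_blocks hn hk hr0 hr1 hrt h1 h2 hx List.suffix_rfl
  rw [hx] at hup hmid
  have hlow := ((path_start hn hr0 hr1).append hmid).append
    (path_final hn hr0 hr1 hrt hr2 h1 h2)
  rw [← blockDigits_eq] at hlow
  rw [← upperDigits_eq] at hup
  obtain ⟨hd, hL⟩ := hlow.digits hn
  have hR := (hup.digits hn).2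
  have eL : leftEnd n α = ((α * tr n - tr n : ℝ) : OnePoint ℝ) := by
    rw [leftEnd, sub_mul, one_mul]
  have hL' : leftOrbit n α (lowerDigits n k v).length =
      ((x / (1 - tr n * x) : ℝ) : OnePoint ℝ) := by
    rw [leftOrbit, eL]; exact hL
  have hR' : rightOrbit n α (upperDigits k v).length = (x : OnePoint ℝ) := hR
  refine ⟨by rw [eL]; exact hd, ?_, ?_⟩
  · rw [hL', hR', parabolic_smul hden]
  · have sL : leftOrbit n α ((lowerDigits n k v).length + 1) =
        cfMap n α (leftOrbit n α (lowerDigits n k v).length) := Function.iterate_succ_apply' _ _ _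
    have sR : rightOrbit n α ((upperDigits k v).length + 1) =
        cfMap n α (rightOrbit n α (upperDigits k v).length) := Function.iterate_succ_apply' _ _ _
    rw [sL, sR, hL', hR', cfMap_eq_cfMap_parabolic hn hr0 hr1 hr2 h2]

end AlphaCF

theorem mainTheorem8 (n : ℕ) (hn : 3 ≤ n) (k : ℕ) (hk : 1 ≤ k) (v : List ℕ)
    (hv : v ∈ AlphaCF.words) :
    (∀ α ∈ AlphaCF.syncInterval n k v,
      AlphaCF.HasInitialSimplifiedDigits n α (AlphaCF.leftEnd n α) (AlphaCF.lowerDigits n k v)) ∧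
    (AlphaCF.leftMatrix n k v =
        AlphaCF.matC⁻¹ * AlphaCF.matA n * AlphaCF.matC * AlphaCF.rightMatrix n k v ∨
      AlphaCF.leftMatrix n k v =
        -(AlphaCF.matC⁻¹ * AlphaCF.matA n * AlphaCF.matC * AlphaCF.rightMatrix n k v)) ∧
    (∀ α ∈ AlphaCF.syncInterval n k v,
      AlphaCF.leftOrbit n α (AlphaCF.lowerDigits n k v).length =
          (AlphaCF.matC⁻¹ * AlphaCF.matA n * AlphaCF.matC) •
            AlphaCF.rightOrbit n α (AlphaCF.upperDigits k v).length ∧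
        AlphaCF.leftOrbit n α ((AlphaCF.lowerDigits n k v).length + 1) =
          AlphaCF.rightOrbit n α ((AlphaCF.upperDigits k v).length + 1)) := ⟨fun _ hα => (AlphaCF.synchronization hn hk hv hα).1, AlphaCF.leftMatrix_eq hn hk v,
    fun _ hα => (AlphaCF.synchronization hn hk hv hα).2⟩
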